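/- Let $\alpha,\theta>0$ and $\rho_*<1$. There are constants $C_1,C_2,C_3>0$, depending only on $\alpha,\theta,\rho_*$, such that the following holds. Let $D\ge 1$, let $\Sigma$ be a positive definite real $D\times D$ matrix, and let $$p(x)=\frac{1}{\sqrt{(2\pi)^D\det\Sigma}}\exp\left(-\tfrac12x^\top\Sigma^{-1}x\right)$$ be the density of the $D$-dimensional normal distribution with mean zero and covariance matrix $\Sigma$. Let $G$ be a finite tree, and let each of the variables $x_1,\dots,x_D$ be attached to a vertex of $G$. Removing an edge $e$ of $G$ splits the variables into two groups; write $\Sigma_{11},\Sigma_{12},\Sigma_{21},\Sigma_{22}$ for the corresponding blocks of $\Sigma$. The canonical correlations $\rho_1^{(e)}\ge\rho_2^{(e)}\ge\cdots$ of this bipartition are the positive solutions $\rho$, with multiplicity, of the generalized eigenvalue problem $$\begin{pmatrix}0&\Sigma_{12}\\ \Sigma_{21}&0\end{pmatrix}\begin{pmatrix}u\\ w\end{pmatrix}=\rho\begin{pmatrix}\Sigma_{11}&0\\ 0&\Sigma_{22}\end{pmatrix}\begin{pmatrix}u\\ w\end{pmatrix},$$ followed by zeros. Suppose that for every edge $e$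 and every $j\ge1$ $$\rho_j^{(e)}\le\rho_*<1\qquad\text{and}\qquad \rho_j^{(e)}\le\alpha e^{-\theta j}.$$ A functional tree tensor network (TTN) on $G$ has a virtual index with finitely many (at least one) values for every edge of $G$ and, for every vertex $v$, a tensor $\gamma_v$ that depends on the virtual indices of the edges at $v$ and is, for all fixed values of these, a real $L^2$ function of the variables attached to $v$. It represents the function obtained by summing $\prod_v\gamma_v$ over all values of the virtual indices, and its bond dimension $\chi$ is the largest number of values of a virtual index. Then for every $0<\epsilon\le1$ there is a functional TTN on $G$, representing a function $\tilde\psi$ on $\mathbb R^D$, such that $\psi=\sqrt p$ satisfies $$\|\psi-\tilde\psi\|_{L^2(\mathbb R^D)}\le\epsilon$$ and the bond dimension satisfies $$\chi\le\left(\frac{C_2\sqrt D}{\epsilon}\right)^{C_1\log\left(C_3\log\left(\frac{2C_1\log\left(\frac{C_2\sqrt D}{\epsilon}\right)\sqrt D}{\epsilon}\right)\right)}.$$ Moreover, for all these $D$ and $\epsilon$, the two inner logarithms have arguments greater than $1$, that is, $C_2\sqrt D/\epsilon>1$ and $2C_1\log(C_2\sqrt D/\epsilon)\sqrt D/\epsilon>1$,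 so that the bound is well defined. -/

import Mathlib

open MeasureTheory

/-- The density of the centred normal distribution on `ℝ^D` with covariance matrix `S`. -/
noncomputable def normalDensity {D : ℕ} (S : Matrix (Fin D) (Fin D) ℝ) (x : Fin D → ℝ) : ℝ :=
  1 / Real.sqrt ((2 * Real.pi) ^ D * S.det) * Real.exp (-(1 / 2) * (x ⬝ᵥ S⁻¹.mulVec x))

open Classical in
/-- For the bipartition of the variables into `A` and its complement: the block-diagonal part
`diag(S₁₁, S₂₂)` of `S`. -/
noncomputable def withinBlocks {D : ℕ} (S : Matrix (Fin D) (Fin D) ℝ) (A : Set (Fin D)) :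
    Matrix (Fin D) (Fin D) ℝ :=
  Matrix.of fun i j => if (i ∈ A ↔ j ∈ A) then S i j else 0

open Classical in
/-- For the bipartition of the variables into `A` and its complement: the off-diagonal part of `S`,
with blocks `S₁₂` and `S₂₁`. -/
noncomputable def acrossBlocks {D : ℕ} (S : Matrix (Fin D) (Fin D) ℝ) (A : Set (Fin D)) :
    Matrix (Fin D) (Fin D) ℝ :=
  Matrix.of fun i j => if (i ∈ A ↔ j ∈ A) then 0 else S i j

/-- The polynomial `det (t • diag(S₁₁, S₂₂) - offdiag(S₁₂, S₂₁))` in `t`, whose roots are the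
solutions (with multiplicity) of the generalized eigenvalue problem of canonical correlation
analysis. -/
noncomputable def canonicalPoly {D : ℕ} (S : Matrix (Fin D) (Fin D) ℝ) (A : Set (Fin D)) :
    Polynomial ℝ :=
  Matrix.det ((Polynomial.X : Polynomial ℝ) • (withinBlocks S A).map Polynomial.C
    - (acrossBlocks S A).map Polynomial.C)

open Classical in
/-- The positive canonical correlations between the variables in `A` and those outside `A`, with
multiplicity and in descending order. -/
noncomputable def canonicalCorrList {D : ℕ} (S : Matrix (Fin D) (Fin D) ℝ) (A : Set (Fin D)) :
    List ℝ :=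
  ((canonicalPoly S A).roots.filter fun t => 0 < t).sort (· ≥ ·)

/-- The `j`-th largest canonical correlation, counted from `j = 0` (so that this is `ρ_{j+1}` in
the usual numbering); it is `0` once the positive ones are exhausted. -/
noncomputable def canonicalCorr {D : ℕ} (S : Matrix (Fin D) (Fin D) ℝ) (A : Set (Fin D))
    (j : ℕ) : ℝ :=
  (canonicalCorrList S A).getD j 0

/-- Variable `i` is attached to the vertex `site i`. These are the variables on the side of `u`
after the edge `{u, v}` has been removed. -/
def edgeSide {V : Type*} {D : ℕ} (G : SimpleGraph V) (site : Fin D → V) (u v : V) :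
    Set (Fin D) :=
  {i | (G.deleteEdges {s(u, v)}).Reachable u (site i)}

open Classical in
/-- A functional tensor network with real `L²` tensors on the graph `G`, where variable `i` of
`ℝ^D` is attached to the vertex `site i`. Every edge `e` of `G` carries a virtual index with
`bondDim e` values. The tensor at `v` has the virtual indices of the edges incident to `v` and the
variables attached to `v` as its arguments. It is a tree tensor network when `G` is a tree. -/
structure FunctionalTN {V : Type*} [Fintype V] {D : ℕ} (G : SimpleGraph V) (site : Fin D → V) where
  bondDim : G.edgeSet → ℕ
  bondDim_pos : ∀ e, 0 < bondDim e
  tensor : (v : V) → ((e : {e : G.edgeSet // v ∈ (e : Sym2 V)}) → Fin (bondDim e.1)) →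
    ({i : Fin D // site i = v} → ℝ) → ℝ
  memLp_tensor : ∀ v a, MemLp (tensor v a) 2 volume

namespace FunctionalTN

open Classical in
/-- The function on `ℝ^D` represented by the network: the sum over all virtual indices of the
product of all tensors. -/
noncomputable def toFun {V : Type*} [Fintype V] {D : ℕ} {G : SimpleGraph V} {site : Fin D → V}
    (T : FunctionalTN G site) (x : Fin D → ℝ) : ℝ :=
  ∑ a : (e : G.edgeSet) → Fin (T.bondDim e),
    ∏ v : V, T.tensor v (fun e => a e.1) (fun i => x i.1)

open Classical in
/-- The bond dimension of the network: the largest dimension of a virtual index. -/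
noncomputable def maxBondDim {V : Type*} [Fintype V] {D : ℕ} {G : SimpleGraph V}
    {site : Fin D → V} (T : FunctionalTN G site) : ℕ :=
  Finset.univ.sup T.bondDim

end FunctionalTN

/-!
Square roots of normal densities are approximated by tree tensor networks with bond dimension
polynomial in `D / ε`, which is more than the bound asks for: the constants are chosen so that the
exponent `C₁ * log (C₃ * log ...)` is at least `4`.

Across one bipartition, simultaneous diagonalisation of the within-block and cross-block parts of
the covariance (`exists_isCanonical`) gives coordinates `y = Tᵀ x` and numbers `μ j`, which are the
canonical correlations with both signs. With `Y` and `Y'` the parts of `y` coming from the two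
groups of variables, `√p` is a product of a Gaussian in `Y`, a Gaussian in `Y'` and the coupling
`exp (∑ b j * Y j * Y' j)`, `b j = μ j / (2 * (1 - μ j ^ 2))`. The power series of the coupling is
truncated to the multi-indices `n` of weight `∏ √|μ j| ^ n j ≥ δ` (`exists_truncation`). As the
correlations are dominated by a geometric sequence, the sum of all weights is at most a constant
`K ^ 2`, so that at most `K ^ 2 / δ` terms remain. The remainder is bounded pointwise by `δ` times
a wider Gaussian, whose `L²` norm is at most `K ^ 2` in every dimension
(`exists_gaussian_approx`).

To reach low rank across all edges at once, everything is sampled on a fine grid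
(`tendsto_eLpNorm_sub_stepFn`), which turns `√p` into a finite tensor. The sets of variables below
the edges of the rooted tree form a laminar family with at most `(D + 1) ^ 2` members, however many
vertices the tree has. Orthogonal projections in the variables of these sets, the large ones first,
produce one tensor of low rank across every edge, and the errors add up
(`exists_hasRankLE_laminar`). Finally a function of low rank across every edge is a tree tensor
network: cutting the edges one by one, the function is interpolated in the variables below each edge
(`HasRankLE.exists_interpolation`, `exists_network`).
-/

/-! ### Functions of low rank across a bipartition of the variables -/

section Splice

variable {I ι : Type*}

open Classical in
/-- The point that agrees with `y` on `A` and with `x` off `A`. -/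
noncomputable def splice (A : Set I) (y x : I → ι) : I → ι := fun i => if i ∈ A then y i else x i

theorem splice_of_mem {A : Set I} {i : I} (h : i ∈ A) (y x : I → ι) : splice A y x i = y i := by
  simp [splice, h]

theorem splice_of_notMem {A : Set I} {i : I} (h : i ∉ A) (y x : I → ι) :
    splice A y x i = x i := by
  simp [splice, h]

theorem splice_self (A : Set I) (x : I → ι) : splice A x x = x := by
  ext i; simp [splice]

/-- `f` is a sum of `χ` products of a function of the variables in `A` with a function of the
remaining variables. -/
def HasRankLE (χ : ℕ) (A : Set I) (f : (I → ι) → ℝ) : Prop :=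
  ∃ u g : Fin χ → (I → ι) → ℝ, (∀ i, DependsOn (u i) A) ∧ (∀ i, DependsOn (g i) Aᶜ) ∧
    ∀ x, f x = ∑ i, u i x * g i x

theorem DependsOn.apply_splice {A : Set I} {u : (I → ι) → ℝ} (hu : DependsOn u A)
    (y x : I → ι) : u (splice A y x) = u y :=
  hu fun _ hi => splice_of_mem hi y x

theorem DependsOn.apply_splice_compl {A B : Set I} {g : (I → ι) → ℝ} (hg : DependsOn g B)
    (hAB : Disjoint A B) (y x : I → ι) : g (splice A y x) = g x :=
  hg fun _ hi => splice_of_notMem (fun h => hAB.le_bot ⟨h, hi⟩) y x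

end Splice

/-! ### Orthogonal projections acting on some of the variables -/

section Projection

variable {I ι : Type*}

/-- The function `f` with the variables off `A` frozen at the values they have in `x`. -/
noncomputable def slice (A : Set I) (f : (I → ι) → ℝ) (x : I → ι) : EuclideanSpace ℝ (I → ι) :=
  WithLp.toLp 2 fun y => f (splice A y x)

theorem slice_congr {A : Set I} (f : (I → ι) → ℝ) {x x' : I → ι} (h : ∀ i ∈ Aᶜ, x i = x' i) :
    slice A f x = slice A f x' := by
  unfold slice
  congr 1; ext y; congr 1; ext i
  by_cases hi : i ∈ A
  · simp [splice, hi]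
  · simp [splice, hi, h i hi]

/-- The subspace `U` consists of functions of the variables in `A`. -/
def SupportedOn (A : Set I) (U : Submodule ℝ (EuclideanSpace ℝ (I → ι))) : Prop :=
  ∀ v ∈ U, DependsOn (fun x => v x) A

theorem supportedOn_span {χ : ℕ} {A : Set I} {u : Fin χ → (I → ι) → ℝ}
    (hu : ∀ i, DependsOn (u i) A) :
    SupportedOn A (Submodule.span ℝ (Set.range fun i => (WithLp.toLp 2 (u i)))) := by
  intro v hv x y h
  obtain ⟨c, rfl⟩ := (Submodule.mem_span_range_iff_exists_fun ℝ).1 hv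
  simp [fun i => hu i h]

variable [Fintype I] [Fintype ι] [DecidableEq I]

/-- Exchanging the `A`-coordinates of two points is a bijection, so averaging over both leaves
the sum of a function of one of them unchanged up to the number of points. -/
theorem sum_sum_splice (A : Set I) (F : (I → ι) → ℝ) :
    ∑ x : I → ι, ∑ z : I → ι, F (splice A z x) = Fintype.card (I → ι) * ∑ x, F x := by
  have hinv : Function.Involutive
      (fun p : (I → ι) × (I → ι) => (splice A p.2 p.1, splice A p.1 p.2)) := by
    rintro ⟨x, z⟩
    ext i <;> by_cases hi : i ∈ A <;> simp [splice, hi]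
  rw [← Fintype.sum_prod_type' (f := fun x z => F (splice A z x))]
  rw [Fintype.sum_equiv hinv.toPerm (fun p => F (splice A p.2 p.1)) (fun p => F p.1) fun p => rfl]
  rw [Fintype.sum_prod_type]
  simp [Finset.mul_sum]

/-- The orthogonal projection onto `U`, applied in the variables in `A` with the others fixed. -/
noncomputable def partialProj (A : Set I) (U : Submodule ℝ (EuclideanSpace ℝ (I → ι)))
    (f : (I → ι) → ℝ) (x : I → ι) : ℝ :=
  (U.starProjection (slice A f x)) x

theorem partialProj_sub (A : Set I) (U : Submodule ℝ (EuclideanSpace ℝ (I → ι)))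
    (f g : (I → ι) → ℝ) :
    partialProj A U (f - g) = partialProj A U f - partialProj A U g := by
  ext x
  have : slice A (f - g) x = slice A f x - slice A g x := rfl
  simp [partialProj, this]

theorem partialProj_sum (A : Set I) (U : Submodule ℝ (EuclideanSpace ℝ (I → ι))) {n : ℕ}
    (f : Fin n → (I → ι) → ℝ) (x : I → ι) :
    partialProj A U (fun x => ∑ i, f i x) x = ∑ i, partialProj A U (f i) x := by
  have : slice A (fun x => ∑ i, f i x) x = ∑ i, slice A (f i) x := by
    ext y; simp [slice]
  simp [partialProj, this]

theorem partialProj_mul (A : Set I) (U : Submodule ℝ (EuclideanSpace ℝ (I → ι)))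
    {u : (I → ι) → ℝ} (hu : DependsOn u Aᶜ) (f : (I → ι) → ℝ) (x : I → ι) :
    partialProj A U (fun x => u x * f x) x = u x * partialProj A U f x := by
  have : slice A (fun x => u x * f x) x = u x • slice A f x := by
    ext y
    simp [slice, hu.apply_splice_compl disjoint_compl_right]
  simp [partialProj, this]

theorem partialProj_dependsOn {A B : Set I} {U : Submodule ℝ (EuclideanSpace ℝ (I → ι))}
    (hU : SupportedOn A U) (hAB : A ⊆ B) {f : (I → ι) → ℝ} (hf : DependsOn f B) :
    DependsOn (partialProj A U f) B := by
  intro x x' h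
  have : slice A f x = slice A f x' := by
    unfold slice
    congr 1; ext y
    refine hf fun i hi => ?_
    by_cases hiA : i ∈ A
    · simp [splice, hiA]
    · simp [splice, hiA, h i hi]
  unfold partialProj
  rw [this]
  exact hU _ (U.starProjection_apply_mem _) fun i hi => h i (hAB hi)

theorem sum_norm_slice_sq (A : Set I) (f : (I → ι) → ℝ) :
    ∑ x, ‖slice A f x‖ ^ 2 = Fintype.card (I → ι) * ‖WithLp.toLp 2 f‖ ^ 2 := by
  simp only [EuclideanSpace.real_norm_sq_eq, slice]
  exact sum_sum_splice A fun x => f x ^ 2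

/-- The `ℓ²` norm of a function given slice by slice through functions of the variables in `A`. -/
theorem card_mul_norm_sq_eq {A : Set I} (φ : (I → ι) → EuclideanSpace ℝ (I → ι))
    (hφ : ∀ x, DependsOn (fun z => φ x z) A)
    (hφ' : ∀ x x' : I → ι, (∀ i ∈ Aᶜ, x i = x' i) → φ x = φ x') :
    (Fintype.card (I → ι) : ℝ) * ‖(WithLp.toLp 2 fun x => φ x x : EuclideanSpace ℝ (I → ι))‖ ^ 2 =
      ∑ x, ‖φ x‖ ^ 2 := by
  simp only [EuclideanSpace.real_norm_sq_eq]
  rw [← sum_sum_splice A]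
  refine Finset.sum_congr rfl fun x _ => Finset.sum_congr rfl fun z _ => ?_
  have h1 : φ (splice A z x) = φ x := hφ' _ _ fun i hi => splice_of_notMem hi z x
  rw [h1]
  congr 1
  exact (hφ x).apply_splice z x

theorem norm_le_of_card_mul_le {f : EuclideanSpace ℝ (I → ι)} {b : ℝ} (hb : 0 ≤ b)
    (h : (Fintype.card (I → ι) : ℝ) * ‖f‖ ^ 2 ≤ Fintype.card (I → ι) * b ^ 2) : ‖f‖ ≤ b := by
  rcases isEmpty_or_nonempty (I → ι) with he | he
  · have : f = 0 := by ext x; exact he.elim x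
    simpa [this] using hb
  · have : (0 : ℝ) < Fintype.card (I → ι) := by exact_mod_cast Fintype.card_pos
    exact le_of_sq_le_sq (le_of_mul_le_mul_left h this) hb

theorem norm_partialProj_le {A : Set I} {U : Submodule ℝ (EuclideanSpace ℝ (I → ι))}
    (hU : SupportedOn A U) (f : (I → ι) → ℝ) :
    ‖WithLp.toLp 2 (partialProj A U f)‖ ≤ ‖WithLp.toLp 2 f‖ := by
  refine norm_le_of_card_mul_le (norm_nonneg _) ?_
  have := card_mul_norm_sq_eq (A := A) (fun x => U.starProjection (slice A f x))
    (fun x => hU _ (U.starProjection_apply_mem _)) (fun x x' h => by rw [slice_congr f h])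
  unfold partialProj
  rw [this, ← sum_norm_slice_sq A f]
  gcongr with x
  exact U.norm_starProjection_apply_le _

/-- The projection is at least as close to `f` as any function whose slices lie in `U`. -/
theorem norm_sub_partialProj_le {A : Set I} {U : Submodule ℝ (EuclideanSpace ℝ (I → ι))}
    (hU : SupportedOn A U) (f f' : (I → ι) → ℝ) (hf' : ∀ x, slice A f' x ∈ U) :
    ‖WithLp.toLp 2 (f - partialProj A U f)‖ ≤ ‖WithLp.toLp 2 (f - f')‖ := by
  have hfix : partialProj A U f' = f' := by
    ext x
    unfold partialProj
    rw [Submodule.starProjection_eq_self_iff.2 (hf' x)]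
    simp [slice, splice_self]
  have hdecomp : f - partialProj A U f = (f - f') - partialProj A U (f - f') := by
    rw [partialProj_sub, hfix]; abel
  rw [hdecomp]
  set h := f - f'
  have hslice : ∀ x, h x - partialProj A U h x = (Uᗮ.starProjection (slice A h x)) x := by
    intro x
    have hx : h x = (slice A h x) x := by simp [slice, splice_self]
    rw [Submodule.starProjection_orthogonal', hx, partialProj]
    simp
  refine norm_le_of_card_mul_le (norm_nonneg _) ?_
  -- The slices of `h` and their projections onto `U` are functions of the variables in `A`, hence
  -- so are the residuals.
  have key : (Fintype.card (I → ι) : ℝ) * ‖WithLp.toLp 2 (h - partialProj A U h)‖ ^ 2 =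
      ∑ x, ‖Uᗮ.starProjection (slice A h x)‖ ^ 2 := by
    have h2 : h - partialProj A U h = fun x => (Uᗮ.starProjection (slice A h x)) x := by
      ext x; exact hslice x
    rw [h2]
    refine card_mul_norm_sq_eq (A := A) _ (fun x => ?_) (fun x x' hx => by rw [slice_congr h hx])
    intro z z' hz
    have hs : (slice A h x) z = (slice A h x) z' := by
      simp only [slice]
      congr 1; ext i
      by_cases hi : i ∈ A
      · simp [splice, hi, hz i hi]
      · simp [splice, hi]
    have hp := hU _ (U.starProjection_apply_mem (slice A h x)) hz
    simp only at hp
    simp [Submodule.starProjection_orthogonal', hs, hp]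
  rw [key, ← sum_norm_slice_sq A h]
  gcongr with x
  exact Uᗮ.norm_starProjection_apply_le _

theorem hasRankLE_partialProj_span {χ : ℕ} {A : Set I} {u : Fin χ → (I → ι) → ℝ}
    (hu : ∀ i, DependsOn (u i) A) (f : (I → ι) → ℝ) :
    HasRankLE χ A
      (partialProj A (Submodule.span ℝ (Set.range fun i => (WithLp.toLp 2 (u i)))) f) := by
  set U := Submodule.span ℝ (Set.range fun i => (WithLp.toLp 2 (u i)))
  have hex : ∀ v, ∃ c : Fin χ → ℝ, ∑ i, c i • (WithLp.toLp 2 (u i)) = U.starProjection v :=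
    fun v => (Submodule.mem_span_range_iff_exists_fun ℝ).1 (U.starProjection_apply_mem v)
  choose c hc using hex
  refine ⟨u, fun i x => c (slice A f x) i, hu, fun i x x' h => ?_, fun x => ?_⟩
  · simp only [slice_congr f h]
  · simp only [partialProj, ← hc]
    simp [mul_comm]

theorem HasRankLE.partialProj {χ : ℕ} {A B : Set I} {f : (I → ι) → ℝ} (hf : HasRankLE χ B f)
    {U : Submodule ℝ (EuclideanSpace ℝ (I → ι))} (hU : SupportedOn A U)
    (hAB : A ⊆ B ∨ Disjoint A B) : HasRankLE χ B (partialProj A U f) := by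
  obtain ⟨u, g, hu, hg, hfg⟩ := hf
  rcases hAB with hAB | hAB
  · refine ⟨fun i => _root_.partialProj A U (u i), g,
      fun i => partialProj_dependsOn hU hAB (hu i), hg, fun x => ?_⟩
    have : f = fun x => ∑ i, g i x * u i x := by ext x; simp [hfg, mul_comm]
    rw [this, partialProj_sum]
    refine Finset.sum_congr rfl fun i _ => ?_
    rw [partialProj_mul A U ((hg i).mono (Set.compl_subset_compl.2 hAB)), mul_comm]
  · have hAB' : A ⊆ Bᶜ := hAB.subset_compl_right
    refine ⟨u, fun i => _root_.partialProj A U (g i), hu,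
      fun i => partialProj_dependsOn hU hAB' (hg i), fun x => ?_⟩
    have : f = fun x => ∑ i, u i x * g i x := by ext x; simp [hfg]
    rw [this, partialProj_sum]
    refine Finset.sum_congr rfl fun i _ => ?_
    rw [partialProj_mul A U ((hu i).mono hAB.subset_compl_left)]

/-- If `f` is `η`-close to a function of rank at most `χ` across each set of a laminar family, then
a single function, close to `f`, has rank at most `χ` across all of them. Projecting across the
large sets first keeps the ranks that have been reached. -/
theorem exists_hasRankLE_laminar {χ : ℕ} {η : ℝ} (f : (I → ι) → ℝ)
    (𝒜 : Finset (Set I))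
    (hlam : ∀ A ∈ 𝒜, ∀ B ∈ 𝒜, A ⊆ B ∨ B ⊆ A ∨ Disjoint A B)
    (happ : ∀ A ∈ 𝒜, ∃ f', HasRankLE χ A f' ∧ ‖WithLp.toLp 2 (f - f')‖ ≤ η) :
    ∃ f', (∀ A ∈ 𝒜, HasRankLE χ A f') ∧ ‖WithLp.toLp 2 (f - f')‖ ≤ 𝒜.card * η := by
  classical
  induction 𝒜 using Finset.induction_on_min_value (fun A : Set I => A.ncard) with
  | empty => exact ⟨f, by simp, by simp⟩
  | insert A s hA hmin ih =>
    obtain ⟨f₁, hr, hn⟩ := ih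
      (fun B hB C hC => hlam B (Finset.mem_insert_of_mem hB) C (Finset.mem_insert_of_mem hC))
      (fun B hB => happ B (Finset.mem_insert_of_mem hB))
    obtain ⟨f', ⟨u, g, hu, hg, hug⟩, hf'⟩ := happ A (Finset.mem_insert_self _ _)
    set U := Submodule.span ℝ (Set.range fun i => (WithLp.toLp 2 (u i)))
    have hU : SupportedOn A U := supportedOn_span hu
    refine ⟨partialProj A U f₁, fun B hB => ?_, ?_⟩
    · rcases Finset.mem_insert.1 hB with rfl | hB'
      · exact hasRankLE_partialProj_span hu f₁
      · refine (hr B hB').partialProj hU ?_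
        rcases hlam A (Finset.mem_insert_self _ _) B hB with h | h | h
        · exact Or.inl h
        · exact Or.inl (Set.eq_of_subset_of_ncard_le h (hmin B hB') A.toFinite).symm.subset
        · exact Or.inr h
    · have hsl : ∀ x, slice A f' x ∈ U := by
        intro x
        refine (Submodule.mem_span_range_iff_exists_fun ℝ).2 ⟨fun i => g i x, ?_⟩
        ext y
        simp [slice, hug, (hu _).apply_splice, (hg _).apply_splice_compl disjoint_compl_right,
          mul_comm]
      have h1 := (norm_sub_partialProj_le hU f f' hsl).trans hf'
      have h2 := (norm_partialProj_le hU (f - f₁)).trans hn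
      rw [partialProj_sub] at h2
      rw [Finset.card_insert_of_notMem hA]
      calc ‖WithLp.toLp 2 (f - partialProj A U f₁)‖
          = ‖WithLp.toLp 2 (f - partialProj A U f) +
              WithLp.toLp 2 (partialProj A U f - partialProj A U f₁)‖ := by
            rw [← WithLp.toLp_add]; congr 2; abel
        _ ≤ _ := norm_add_le _ _
        _ ≤ η + s.card * η := add_le_add h1 h2
        _ = _ := by push_cast; ring

end Projection

/-! ### Interpolation of low-rank functions -/

/-- A function of rank at most `χ` across `A` is recovered from its restrictions to `χ` values of
the variables in `A`; the interpolation weights are combinations of the slices of `f`. -/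
theorem HasRankLE.exists_interpolation {I ι : Type*} [Fintype I] [Fintype ι] [DecidableEq I]
    [Nonempty (I → ι)] {χ : ℕ} {A : Set I} {f : (I → ι) → ℝ} (hf : HasRankLE χ A f) :
    ∃ (p : Fin χ → I → ι) (w k : Fin χ → (I → ι) → ℝ), (∀ j, DependsOn (w j) A) ∧
      (∀ x, f x = ∑ j, w j x * f (splice A (p j) x)) ∧
      ∀ j x, w j x = ∑ z, k j z * f (splice A x z) := by
  classical
  obtain ⟨u, g, hu, hg, hfg⟩ := hf
  let F : (I → ι) → (I → ι) → ℝ := fun y z => f (splice A y z)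
  have hF : ∀ y, F y = ∑ i, u i y • g i := by
    intro y; ext z
    simp [F, hfg, (hu _).apply_splice, (hg _).apply_splice_compl disjoint_compl_right]
  have hFdep : ∀ y y' : I → ι, (∀ i ∈ A, y i = y' i) → F y = F y' := by
    intro y y' h
    rw [hF, hF]
    exact Finset.sum_congr rfl fun i _ => by rw [hu i h]
  obtain ⟨κ, a, ha, hspan, hlin⟩ := exists_linearIndependent' ℝ F
  let b := Module.Basis.span hlin
  have : Finite κ := Finite.of_injective a ha
  have : Fintype κ := Fintype.ofFinite κ
  have hcard : Fintype.card κ ≤ χ := by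
    have h1 : Submodule.span ℝ (Set.range F) ≤ Submodule.span ℝ (Set.range g) := by
      rw [Submodule.span_le]
      rintro _ ⟨y, rfl⟩
      rw [hF]
      exact (Submodule.mem_span_range_iff_exists_fun ℝ).2 ⟨fun i => u i y, rfl⟩
    have h2 := finrank_span_eq_card hlin
    have h3 := finrank_range_le_card (R := ℝ) g
    have h4 := Submodule.finrank_mono h1
    rw [← hspan, h2] at h4
    simpa using h4.trans h3
  obtain ⟨e⟩ : Nonempty (κ ↪ Fin χ) := Function.Embedding.nonempty_of_card_le (by simpa)
  have hext : ∀ j : κ, ∃ l : ((I → ι) → ℝ) →ₗ[ℝ] ℝ, ∀ v : Submodule.span ℝ (Set.range (F ∘ a)),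
      l v = b.repr v j := by
    intro j
    obtain ⟨l, hl⟩ := LinearMap.exists_extend (b.coord j)
    exact ⟨l, fun v => by rw [← Module.Basis.coord_apply, ← hl]; rfl⟩
  choose l hl using hext
  have hrow : ∀ y, F y = ∑ j, l j (F y) • F (a j) := by
    intro y
    have hmem : F y ∈ Submodule.span ℝ (Set.range (F ∘ a)) := by
      rw [hspan]; exact Submodule.subset_span ⟨y, rfl⟩
    have h := congrArg Subtype.val (b.sum_repr ⟨F y, hmem⟩)
    rw [Submodule.coe_sum] at h
    have h2 : ∀ j, ((b j : Submodule.span ℝ (Set.range (F ∘ a))) : (I → ι) → ℝ) = F (a j) := by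
      intro j; simp [b, Module.Basis.span_apply]
    simp only [Submodule.coe_smul, h2] at h
    conv_lhs => rw [← h]
    refine Finset.sum_congr rfl fun j _ => ?_
    rw [← hl j ⟨F y, hmem⟩]
  let d : I → ι := Classical.arbitrary _
  refine ⟨Function.extend e a fun _ => d,
    Function.extend e (fun j y => l j (F y)) fun _ => 0,
    Function.extend e (fun j z => l j (Pi.single z 1)) fun _ => 0, ?_, ?_, ?_⟩
  · intro j
    by_cases hj : ∃ i, e i = j
    · obtain ⟨i, rfl⟩ := hj
      rw [e.injective.extend_apply]
      intro y y' h
      simp only [hFdep y y' h]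
    · rw [Function.extend_apply' _ _ _ hj]
      intro _ _ _; rfl
  · intro x
    have h := congrFun (hrow x) x
    simp only [F, splice_self, Finset.sum_apply, Pi.smul_apply, smul_eq_mul] at h
    rw [h]
    refine Fintype.sum_of_injective e e.injective _ _ (fun j hj => ?_) fun j => ?_
    · rw [Function.extend_apply' _ _ _ (by simpa using hj)]; simp
    · simp only [e.injective.extend_apply, F]
  · intro j x
    by_cases hj : ∃ i, e i = j
    · obtain ⟨i, rfl⟩ := hj
      simp only [e.injective.extend_apply]
      conv_lhs => rw [LinearMap.pi_apply_eq_sum_univ (l i) (F x)]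
      refine Finset.sum_congr rfl fun z _ => ?_
      simp only [F, smul_eq_mul, mul_comm]
      congr 2
      ext w; simp [Pi.single_apply, eq_comm]
    · simp only [Function.extend_apply' _ _ _ hj]; simp

/-! ### Rooted trees and the descendants of a vertex -/

section Rooted

variable {V : Type*} {par : V → V} {r : V} {depth : V → ℕ}

/-- `u` is a descendant of `v` (or `v` itself) for the parent function `par`. -/
def Below (par : V → V) (u v : V) : Prop := ∃ k : ℕ, par^[k] u = v

theorem Below.refl (par : V → V) (v : V) : Below par v v := ⟨0, rfl⟩

theorem Below.trans {u v t : V} (h : Below par u v) (h' : Below par v t) : Below par u t := by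
  obtain ⟨k, rfl⟩ := h
  obtain ⟨l, rfl⟩ := h'
  exact ⟨l + k, Function.iterate_add_apply par l k u⟩

theorem below_par (par : V → V) (v : V) : Below par v (par v) := ⟨1, rfl⟩

theorem Below.eq_or_exists {u v : V} (h : Below par u v) (hr : par r = r) :
    u = v ∨ ∃ c, c ≠ r ∧ par c = v ∧ Below par u c := by
  obtain ⟨k, rfl⟩ := h
  induction k generalizing u with
  | zero => exact Or.inl rfl
  | succ k ih =>
    by_cases hu : u = r
    · subst hu
      left
      rw [Function.iterate_fixed hr]
    rw [Function.iterate_succ_apply]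
    rcases ih (u := par u) with h | ⟨c, hc, hcv, hb⟩
    · exact Or.inr ⟨u, hu, h, Below.refl _ _⟩
    · exact Or.inr ⟨c, hc, hcv, (below_par par u).trans hb⟩

theorem Below.total {u v v' : V} (h : Below par u v) (h' : Below par u v') :
    Below par v v' ∨ Below par v' v := by
  obtain ⟨k, rfl⟩ := h
  obtain ⟨l, rfl⟩ := h'
  rcases le_total k l with hkl | hkl
  · exact Or.inl ⟨l - k, by rw [← Function.iterate_add_apply, Nat.sub_add_cancel hkl]⟩
  · exact Or.inr ⟨k - l, by rw [← Function.iterate_add_apply, Nat.sub_add_cancel hkl]⟩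

theorem Below.depth_le (hr : par r = r) (hd : ∀ v, v ≠ r → depth (par v) < depth v) {u v : V}
    (h : Below par u v) : depth v ≤ depth u := by
  obtain ⟨k, rfl⟩ := h
  induction k generalizing u with
  | zero => exact le_rfl
  | succ k ih =>
    rw [Function.iterate_succ_apply]
    refine (ih (u := par u)).trans ?_
    by_cases hu : u = r
    · rw [hu, hr]
    · exact (hd u hu).le

theorem below_root (hd : ∀ v, v ≠ r → depth (par v) < depth v) (v : V) :
    Below par v r := by
  induction hn : depth v using Nat.strong_induction_on generalizing v with
  | _ n ih =>
    by_cases hv : v = r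
    · exact hv ▸ Below.refl _ _
    · exact (below_par par v).trans (ih _ (hn ▸ hd v hv) _ rfl)

/-- Distinct children of the same vertex are not descendants of each other. -/
theorem Below.eq_of_sibling (hr : par r = r) (hd : ∀ v, v ≠ r → depth (par v) < depth v)
    {c c' : V} (hc' : c' ≠ r) (hp : par c = par c') (h : Below par c c') : c = c' := by
  obtain ⟨k, hk⟩ := h
  cases k with
  | zero => exact hk
  | succ k =>
    rw [Function.iterate_succ_apply] at hk
    have h1 : Below par (par c) c' := ⟨k, hk⟩
    have h2 := h1.depth_le hr hd
    rw [hp] at h2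
    exact absurd (hd c' hc') (by omega)

/-- The variables attached to the descendants of `v`. -/
def belowSet {I : Type*} (par : V → V) (site : I → V) (v : V) : Set I :=
  {i | Below par (site i) v}

theorem belowSet_laminar {I : Type*} (site : I → V) (u v : V) :
    belowSet par site u ⊆ belowSet par site v ∨ belowSet par site v ⊆ belowSet par site u ∨
      Disjoint (belowSet par site u) (belowSet par site v) := by
  by_cases h : Disjoint (belowSet par site u) (belowSet par site v)
  · exact Or.inr (Or.inr h)
  · obtain ⟨i, hu, hv⟩ := Set.not_disjoint_iff.1 h
    rcases Below.total hu hv with h | h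
    · exact Or.inl fun j hj => Below.trans hj h
    · exact Or.inr (Or.inl fun j hj => Below.trans hj h)

theorem belowSet_disjoint {I : Type*} (site : I → V) (hr : par r = r)
    (hd : ∀ v, v ≠ r → depth (par v) < depth v) {c c' : V} (hc : c ≠ r) (hc' : c' ≠ r)
    (hp : par c = par c') (hne : c ≠ c') :
    Disjoint (belowSet par site c) (belowSet par site c') := by
  refine Set.disjoint_left.2 fun i hi hi' => hne ?_
  rcases Below.total hi hi' with h | h
  · exact h.eq_of_sibling hr hd hc' hp
  · exact (h.eq_of_sibling hr hd hc hp.symm).symm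

end Rooted

/-! ### A function of low rank across all edges is a tree tensor network -/

section Contraction

theorem sum_eq_sum_update {V : Type*} [Fintype V] [DecidableEq V] {χ : ℕ} [NeZero χ] (c : V)
    (G : (V → Fin χ) → ℝ) :
    ∑ a, G a = ∑ a : V → Fin χ, (if a c = 0 then 1 else 0) * ∑ j, G (Function.update a c j) := by
  have h : ∀ (j j' : Fin χ) (b : {v // v ≠ c} → Fin χ),
      Function.update ((Equiv.funSplitAt c (Fin χ)).symm (j, b)) c j' =
        (Equiv.funSplitAt c (Fin χ)).symm (j', b) := by
    intro j j' b
    ext v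
    by_cases hv : v = c
    · subst hv; simp [Equiv.funSplitAt]
    · simp [Equiv.funSplitAt, hv]
  rw [← (Equiv.funSplitAt c (Fin χ)).symm.sum_comp, ← (Equiv.funSplitAt c (Fin χ)).symm.sum_comp]
  simp only [h, Fintype.sum_prod_type]
  have h0 : ∀ (j : Fin χ) (b : {v // v ≠ c} → Fin χ),
      (Equiv.funSplitAt c (Fin χ)).symm (j, b) c = j := by
    intro j b; simp [Equiv.funSplitAt]
  simp only [h0, ite_mul, one_mul, zero_mul]
  rw [Finset.sum_comm, Finset.sum_comm (γ := Fin χ)]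
  simp

theorem splice_splice_subset {I ι : Type*} {A B : Set I} (hAB : A ⊆ B) (p x z : I → ι) :
    splice B (splice A p x) z = splice A p (splice B x z) := by
  ext i
  by_cases hA : i ∈ A
  · simp [splice, hA, hAB hA]
  · simp [splice, hA]

theorem splice_comm_of_disjoint {I ι : Type*} {A B : Set I} (hAB : Disjoint A B) (p q x : I → ι) :
    splice A p (splice B q x) = splice B q (splice A p x) := by
  ext i
  by_cases hA : i ∈ A
  · have hB : i ∉ B := fun h => hAB.le_bot ⟨hA, h⟩
    simp [splice, hA, hB]
  · simp [splice, hA]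

variable {V I ι : Type*} [Fintype V] [DecidableEq V] [Fintype I] [DecidableEq I] [Fintype ι]
  [Nonempty (I → ι)] {par : V → V} {r : V} {depth : V → ℕ}

/-- A function whose rank across every edge of a rooted tree is at most `χ` is represented by a
tensor network on the tree. The index `a c` belongs to the edge from `c` to its parent; the index
`a r` of the root is pinned to `0`. The edges are cut one after the other, those near the
root first, by interpolating in the variables below the edge. -/
theorem exists_network (hr : par r = r) (hd : ∀ v, v ≠ r → depth (par v) < depth v)
    (site : I → V) {χ : ℕ} [NeZero χ] (f : (I → ι) → ℝ)
    (hf : ∀ c, c ≠ r → HasRankLE χ (belowSet par site c) f) :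
    ∃ γ : V → (V → Fin χ) → (I → ι) → ℝ,
      (∀ v x, DependsOn (fun a => γ v a x) {c | c ≠ r ∧ (c = v ∨ par c = v)}) ∧
      (∀ v a, DependsOn (γ v a) {i | site i = v}) ∧
      ∀ x, f x = ∑ a : V → Fin χ, (if a r = 0 then 1 else 0) * ∏ v, γ v a x := by
  have hint : ∀ c, ∃ (p : Fin χ → I → ι) (w k : Fin χ → (I → ι) → ℝ), c ≠ r →
      (∀ j, DependsOn (w j) (belowSet par site c)) ∧
      (∀ x, f x = ∑ j, w j x * f (splice (belowSet par site c) (p j) x)) ∧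
      ∀ j x, w j x = ∑ z, k j z * f (splice (belowSet par site c) x z) := by
    intro c
    by_cases hc : c = r
    · exact ⟨fun _ => Classical.arbitrary _, fun _ _ => 0, fun _ _ => 0, fun h => absurd hc h⟩
    · obtain ⟨p, w, k, h⟩ := (hf c hc).exists_interpolation
      exact ⟨p, w, k, fun _ => h⟩
  choose p w k hint using hint
  set A := belowSet par site with hA
  -- The weights at `c` are interpolated below `c` because they are combinations of slices of `f`.
  have hgood : ∀ c c', c ≠ r → c' ≠ r → par c' = c → ∀ j x,
      w c j x = ∑ l, w c' l x * w c j (splice (A c') (p c' l) x) := by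
    intro c c' hc hc' hcc j x
    have hsub : A c' ⊆ A c := fun i hi => Below.trans hi ⟨1, hcc⟩
    have hk := (hint c hc).2.2
    rw [hk]
    simp only [hk, Finset.mul_sum]
    rw [Finset.sum_comm]
    refine Finset.sum_congr rfl fun z _ => ?_
    rw [(hint c' hc').2.1, Finset.mul_sum]
    refine Finset.sum_congr rfl fun l _ => ?_
    rw [splice_splice_subset hsub,
      ((hint c' hc').1 l (fun i hi => splice_of_mem (hsub hi) x z) :
        w c' l (splice (A c) x z) = w c' l x)]
    ring
  have main : ∀ K : Finset V, (∀ v ∈ K, v ≠ r ∧ (par v = r ∨ par v ∈ K)) →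
      ∃ γ : V → (V → Fin χ) → (I → ι) → ℝ,
        (∀ v x, DependsOn (fun a => γ v a x) {c | c ∈ K ∧ (c = v ∨ par c = v)}) ∧
        (∀ v a, v = r ∨ v ∈ K → DependsOn (γ v a)
          {i | i ∈ A v ∧ ∀ c ∈ K, par c = v → i ∉ A c}) ∧
        (∀ v a c, v = r ∨ v ∈ K → c ∉ K → c ≠ r → par c = v → ∀ x,
          γ v a x = ∑ j, w c j x * γ v a (splice (A c) (p c j) x)) ∧
        (∀ v a x, v ≠ r → v ∉ K → γ v a x = 1) ∧
        ∀ x, f x = ∑ a : V → Fin χ, (∏ v, if v ∈ K ∨ a v = 0 then 1 else 0) * ∏ v, γ v a x := by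
    intro K
    induction K using Finset.induction_on_max_value depth with
    | empty =>
      intro _
      refine ⟨fun v _ x => if v = r then f x else 1, ?_, ?_, ?_, ?_, ?_⟩
      · intro v x a a' _; rfl
      · rintro v a (rfl | h) x y hxy
        · have : x = y := by
            ext i
            exact hxy i ⟨below_root hd _, by simp⟩
          rw [this]
        · simp at h
      · rintro v a c (rfl | h) _ hc _ x
        · simpa using (hint c hc).2.1 x
        · simp at h
      · intro v a x hv _
        simp [hv]
      · intro x
        simp only [Finset.prod_ite_eq', Finset.mem_univ, if_true, Finset.notMem_empty, false_or]
        rw [Finset.sum_eq_single (fun _ => 0)]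
        · simp
        · intro a _ ha
          obtain ⟨v, hv⟩ := Function.ne_iff.1 ha
          rw [Finset.prod_eq_zero (Finset.mem_univ v), zero_mul]
          exact if_neg hv
        · simp
    | insert c K hcK hmax ih =>
      intro hK
      obtain ⟨hcr, hcp⟩ := hK c (Finset.mem_insert_self _ _)
      have hpc : par c ≠ c := fun h => by have := hd c hcr; rw [h] at this; omega
      have hcp' : par c = r ∨ par c ∈ K := by
        rcases hcp with h | h
        · exact Or.inl h
        · exact Or.inr ((Finset.mem_insert.1 h).resolve_left hpc)
      have hnochild : ∀ v ∈ K, par v ≠ c := by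
        intro v hv h
        have h1 := hd v (hK v (Finset.mem_insert_of_mem hv)).1
        have h2 := hmax v hv
        rw [h] at h1; omega
      obtain ⟨γ, h1, h2, h3, h4, h5⟩ := ih fun v hv => by
        obtain ⟨ha, hb⟩ := hK v (Finset.mem_insert_of_mem hv)
        refine ⟨ha, hb.imp_right fun hb => (Finset.mem_insert.1 hb).resolve_left ?_⟩
        exact hnochild v hv
      set u := par c with hu
      have hdisj : ∀ c', c' ≠ r → par c' = u → c' ≠ c → Disjoint (A c') (A c) :=
        fun c' hc' hpc' hne => belowSet_disjoint site hr hd hc' hcr hpc' hne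
      refine ⟨fun v a x => if v = c then w c (a c) x else
        if v = u then γ v a (splice (A c) (p c (a c)) x) else γ v a x, ?_, ?_, ?_, ?_, ?_⟩
      · intro v x a a' haa
        have hγ : ∀ y, γ v a y = γ v a' y := fun y =>
          h1 v y fun b hb => haa b ⟨Finset.mem_insert_of_mem hb.1, hb.2⟩
        by_cases hvc : v = c
        · have := haa c ⟨Finset.mem_insert_self _ _, Or.inl hvc.symm⟩
          simp [hvc, this]
        · by_cases hvu : v = u
          · have := haa c ⟨Finset.mem_insert_self _ _, Or.inr (hu.symm.trans hvu.symm)⟩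
            simp only [if_neg hvc, if_pos hvu, this, hγ]
          · simp only [hvc, hvu, if_false, hγ]
      · intro v a hv x y hxy
        by_cases hvc : v = c
        · subst hvc
          simp only [if_true]
          refine (hint v hcr).1 _ fun i hi => hxy i ⟨hi, fun b hb hbv => ?_⟩
          rcases Finset.mem_insert.1 hb with rfl | hb
          · exact absurd hbv hpc
          · exact absurd hbv (hnochild b hb)
        · have hvK : v = r ∨ v ∈ K :=
            hv.imp_right fun h => (Finset.mem_insert.1 h).resolve_left hvc
          by_cases hvu : v = u
          · simp only [if_neg hvc, if_pos hvu]
            refine h2 v a hvK fun i hi => ?_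
            by_cases hic : i ∈ A c
            · simp [splice, hic]
            · simp only [splice, hic, if_false]
              refine hxy i ⟨hi.1, fun b hb hbv => ?_⟩
              rcases Finset.mem_insert.1 hb with rfl | hb
              · exact hic
              · exact hi.2 b hb hbv
          · simp only [hvc, hvu, if_false]
            refine h2 v a hvK fun i hi => hxy i ⟨hi.1, fun b hb hbv => ?_⟩
            rcases Finset.mem_insert.1 hb with rfl | hb
            · exact absurd hbv.symm hvu
            · exact hi.2 b hb hbv
      · intro v a c' hv hc'K hc'r hc'v x
        have hc'K' : c' ∉ K := fun h => hc'K (Finset.mem_insert_of_mem h)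
        have hc'c : c' ≠ c := fun h => hc'K (h ▸ Finset.mem_insert_self _ _)
        by_cases hvc : v = c
        · simp only [hvc, if_true]
          exact hgood c c' hcr hc'r (hc'v.trans hvc) _ x
        · have hvK : v = r ∨ v ∈ K :=
            hv.imp_right fun h => (Finset.mem_insert.1 h).resolve_left hvc
          by_cases hvu : v = u
          · have hdj := hdisj c' hc'r (hc'v.trans hvu) hc'c
            simp only [if_neg hvc, if_pos hvu]
            rw [h3 v a c' hvK hc'K' hc'r hc'v]
            refine Finset.sum_congr rfl fun j _ => ?_
            rw [splice_comm_of_disjoint hdj,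
              ((hint c' hc'r).1 j).apply_splice_compl hdj.symm]
          · simp only [hvc, hvu, if_false]
            exact h3 v a c' hvK hc'K' hc'r hc'v x
      · intro v a x hvr hvK
        rw [Finset.mem_insert, not_or] at hvK
        have hvu : v ≠ u := by
          rintro rfl
          exact hcp'.elim hvr hvK.2
        simp only [hvK.1, hvu, if_false]
        exact h4 v a x hvr hvK.2
      · intro x
        rw [h5, sum_eq_sum_update c
          (fun a => (∏ v, if v ∈ insert c K ∨ a v = 0 then (1 : ℝ) else 0) * _)]
        refine Finset.sum_congr rfl fun a _ => ?_
        have hpin : ∀ j, (∏ v, if v ∈ insert c K ∨ Function.update a c j v = 0 then (1 : ℝ) else 0)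
            = ∏ v ∈ Finset.univ.erase c, if v ∈ K ∨ a v = 0 then 1 else 0 := by
          intro j
          rw [← Finset.mul_prod_erase _ _ (Finset.mem_univ c)]
          simp only [Finset.mem_insert_self, true_or, if_true, one_mul]
          refine Finset.prod_congr rfl fun v hv => ?_
          have hvc := Finset.ne_of_mem_erase hv
          simp [hvc]
        have hpin' : (∏ v, if v ∈ K ∨ a v = 0 then (1 : ℝ) else 0) = (if a c = 0 then 1 else 0) *
            ∏ v ∈ Finset.univ.erase c, if v ∈ K ∨ a v = 0 then 1 else 0 := by
          rw [← Finset.mul_prod_erase _ _ (Finset.mem_univ c)]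
          simp [hcK]
        simp only [hpin]
        rw [hpin', ← Finset.mul_sum, mul_assoc]
        congr 2
        have hγ : ∀ v j y, γ v (Function.update a c j) y = γ v a y := fun v j y =>
          h1 v y fun b hb => by
            have hbc : b ≠ c := fun h => hcK (h ▸ hb.1)
            simp [hbc]
        have huc : u ∈ Finset.univ.erase c := Finset.mem_erase.2 ⟨hpc, Finset.mem_univ _⟩
        rw [← Finset.mul_prod_erase _ _ (Finset.mem_univ c), h4 c a x hcr hcK, one_mul,
          ← Finset.mul_prod_erase _ _ huc, h3 u a c hcp' hcK hcr rfl x, Finset.sum_mul]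
        refine Finset.sum_congr rfl fun j _ => ?_
        rw [← Finset.mul_prod_erase _ _ (Finset.mem_univ c), ← Finset.mul_prod_erase _ _ huc]
        simp only [if_true, Function.update_self, hpc, if_false, hγ]
        rw [mul_assoc]
        congr 2
        refine Finset.prod_congr rfl fun v hv => ?_
        have hvu := Finset.ne_of_mem_erase hv
        have hvc := Finset.ne_of_mem_erase (Finset.mem_of_mem_erase hv)
        simp [hvu, hvc]
  obtain ⟨γ, h1, h2, -, -, h5⟩ := main (Finset.univ.erase r) fun v hv =>
    ⟨Finset.ne_of_mem_erase hv, (eq_or_ne (par v) r).imp_right fun h =>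
      Finset.mem_erase.2 ⟨h, Finset.mem_univ _⟩⟩
  refine ⟨γ, fun v x => (h1 v x).mono fun c hc => ⟨Finset.ne_of_mem_erase hc.1, hc.2⟩,
    fun v a => (h2 v a ?_).mono fun i hi => ?_, fun x => ?_⟩
  · exact (eq_or_ne v r).imp_right fun h => Finset.mem_erase.2 ⟨h, Finset.mem_univ _⟩
  · rcases Below.eq_or_exists (r := r) hi.1 hr with h | ⟨c, hc, hcv, hb⟩
    · exact h
    · exact absurd hb (hi.2 c (Finset.mem_erase.2 ⟨hc, Finset.mem_univ _⟩) hcv)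
  · rw [h5]
    refine Finset.sum_congr rfl fun a _ => ?_
    congr 1
    rw [← Finset.mul_prod_erase _ _ (Finset.mem_univ r)]
    rw [Finset.prod_eq_one]
    · simp
    · intro v hv
      simp [Finset.ne_of_mem_erase hv]

end Contraction

/-! ### Rooting a tree -/

section Tree

variable {V : Type*} {G : SimpleGraph V}

/-- `par` is the parent function of the tree `G` rooted at `r`. -/
structure IsParent (G : SimpleGraph V) (r : V) (par : V → V) : Prop where
  root : par r = r
  adj : ∀ v, v ≠ r → G.Adj v (par v)
  dist_lt : ∀ v, v ≠ r → G.dist r (par v) < G.dist r v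
  eq_of_adj : ∀ u w, G.Adj u w → (u ≠ r ∧ w = par u) ∨ (w ≠ r ∧ u = par w)

theorem edge_parent_injective {r : V} {par : V → V}
    (hd : ∀ v, v ≠ r → G.dist r (par v) < G.dist r v) {u v : V} (hu : u ≠ r) (hv : v ≠ r)
    (h : s(u, par u) = s(v, par v)) : u = v := by
  rcases Sym2.eq_iff.1 h with ⟨h, -⟩ | ⟨h1, h2⟩
  · exact h
  · have h3 := hd u hu
    have h4 := hd v hv
    rw [← h1] at h4
    rw [h2] at h3
    omega

theorem SimpleGraph.IsTree.exists_isParent [Fintype V] (hG : G.IsTree) (r : V) :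
    ∃ par, IsParent G r par := by
  classical
  have hex : ∀ v, v ≠ r → ∃ w, G.Adj v w ∧ G.dist r w < G.dist r v := by
    intro v hv
    obtain ⟨p, hp⟩ := hG.connected.exists_walk_length_eq_dist r v
    have hnil : ¬ p.Nil := SimpleGraph.Walk.not_nil_of_ne hv.symm
    refine ⟨p.penultimate, (p.adj_penultimate hnil).symm, ?_⟩
    have h1 := SimpleGraph.dist_le p.dropLast
    have h2 := SimpleGraph.Walk.not_nil_iff_lt_length.1 hnil
    have h3 : p.dropLast.length = p.length - 1 := by simp
    omega
  choose! par hpar using hex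
  set par' : V → V := Function.update par r r with hpar'
  have hne : ∀ v, v ≠ r → par' v = par v := fun v hv => by simp [hpar', hv]
  have hadj : ∀ v, v ≠ r → G.Adj v (par' v) := fun v hv => by rw [hne v hv]; exact (hpar v hv).1
  have hlt : ∀ v, v ≠ r → G.dist r (par' v) < G.dist r v := fun v hv => by
    rw [hne v hv]; exact (hpar v hv).2
  refine ⟨par', by simp [hpar'], hadj, hlt, fun u w huw => ?_⟩
  -- There are as many edges as vertices other than the root.
  have himage : (Finset.univ.erase r).image (fun v => s(v, par' v)) = G.edgeFinset := by
    refine Finset.eq_of_subset_of_card_le ?_ ?_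
    · intro e he
      obtain ⟨v, hv, rfl⟩ := Finset.mem_image.1 he
      exact SimpleGraph.mem_edgeFinset.2 (hadj v (Finset.ne_of_mem_erase hv))
    · rw [Finset.card_image_of_injOn]
      · have := hG.card_edgeFinset
        rw [Finset.card_erase_of_mem (Finset.mem_univ _), Finset.card_univ]
        omega
      · intro u hu v hv h
        exact edge_parent_injective hlt (Finset.ne_of_mem_erase hu) (Finset.ne_of_mem_erase hv) h
  have hmem : s(u, w) ∈ (Finset.univ.erase r).image (fun v => s(v, par' v)) := by
    rw [himage]; exact SimpleGraph.mem_edgeFinset.2 huw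
  obtain ⟨v, hv, h⟩ := Finset.mem_image.1 hmem
  have hv' := Finset.ne_of_mem_erase hv
  rcases Sym2.eq_iff.1 h with ⟨rfl, rfl⟩ | ⟨rfl, rfl⟩
  · exact Or.inl ⟨hv', rfl⟩
  · exact Or.inr ⟨hv', rfl⟩

/-- The side of `c` after the edge to its parent has been removed is the subtree below `c`. -/
theorem IsParent.edgeSide_eq {r : V} {par : V → V} (h : IsParent G r par) {D : ℕ}
    (site : Fin D → V) {c : V} (hc : c ≠ r) :
    edgeSide G site c (par c) = belowSet par site c := by
  ext i
  change (G.deleteEdges {s(c, par c)}).Reachable c (site i) ↔ Below par (site i) c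
  generalize site i = u
  constructor
  · -- The descendants of `c` are closed under all edges other than the deleted one.
    have hstep : ∀ v w, (G.deleteEdges {s(c, par c)}).Adj v w → Below par v c → Below par w c := by
      intro v w hvw hv
      rw [SimpleGraph.deleteEdges_adj, Set.mem_singleton_iff] at hvw
      rcases h.eq_of_adj v w hvw.1 with ⟨-, rfl⟩ | ⟨-, rfl⟩
      · obtain ⟨k, hk⟩ := hv
        cases k with
        | zero => exact absurd (by rw [show v = c from hk]) hvw.2
        | succ k => exact ⟨k, hk⟩
      · exact (below_par par w).trans hv
    rintro ⟨p⟩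
    have hwalk : ∀ {a b : V}, (G.deleteEdges {s(c, par c)}).Walk a b → Below par a c →
        Below par b c := by
      intro a b p
      induction p with
      | nil => exact id
      | cons hab _ ih => exact fun ha => ih (hstep _ _ hab ha)
    exact hwalk p (Below.refl par c)
  · rintro ⟨k, hk⟩
    induction k generalizing u with
    | zero => exact (show u = c from hk) ▸ SimpleGraph.Reachable.refl _
    | succ k ih =>
      by_cases hur : u = r
      · subst hur
        rw [Function.iterate_fixed h.root] at hk
        exact absurd hk.symm hc
      by_cases huc : u = c
      · exact huc ▸ SimpleGraph.Reachable.refl _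
      refine (ih (par u) hk).trans (SimpleGraph.Adj.reachable (SimpleGraph.Adj.symm ?_))
      rw [SimpleGraph.deleteEdges_adj, Set.mem_singleton_iff]
      exact ⟨h.adj u hur, fun he => huc (edge_parent_injective h.dist_lt hur hc he)⟩

/-- The edges of a rooted tree correspond to the vertices other than the root. -/
noncomputable def IsParent.edgeEquiv {r : V} {par : V → V} (h : IsParent G r par) :
    {v // v ≠ r} ≃ G.edgeSet :=
  Equiv.ofBijective (fun v => ⟨s(v.1, par v.1), h.adj v.1 v.2⟩) <| by
    constructor
    · intro u v huv
      exact Subtype.ext (edge_parent_injective h.dist_lt u.2 v.2 (congrArg Subtype.val huv))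
    · rintro ⟨e, he⟩
      induction e using Sym2.ind with
      | _ u w =>
        rcases h.eq_of_adj u w he with ⟨hu, rfl⟩ | ⟨hw, rfl⟩
        · exact ⟨⟨u, hu⟩, rfl⟩
        · exact ⟨⟨w, hw⟩, Subtype.ext Sym2.eq_swap⟩

theorem IsParent.coe_edgeEquiv {r : V} {par : V → V} (h : IsParent G r par) (v : {v // v ≠ r}) :
    ((h.edgeEquiv v : G.edgeSet) : Sym2 V) = s(v.1, par v.1) := rfl

end Tree

/-! ### Step functions on a grid -/

section Grid

open Filter Topology

/-- The indices of the cells of a grid of mesh `1 / N` on `[-N, N)`. -/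
abbrev GridIdx (N : ℕ) : Type := {k : ℤ // k ∈ Finset.Ico (-(N : ℤ) ^ 2) ((N : ℤ) ^ 2)}

theorem nonempty_gridIdx {N : ℕ} (hN : 0 < N) : Nonempty (GridIdx N) :=
  ⟨⟨0, by rw [Finset.mem_Ico]; constructor <;> [simp; positivity]⟩⟩

variable {I : Type*}

/-- The corner of a grid cell. -/
noncomputable def gridPt (N : ℕ) (m : I → GridIdx N) (i : I) : ℝ := ((m i : ℤ) : ℝ) / N

/-- The cell of the grid with index `m`. -/
def gridCell (N : ℕ) (m : I → GridIdx N) : Set (I → ℝ) := {x | ∀ i, ⌊(N : ℝ) * x i⌋ = m i}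

theorem gridCell_eq_pi {N : ℕ} (hN : 0 < N) (m : I → GridIdx N) :
    gridCell N m = Set.univ.pi fun i =>
      Set.Ico (((m i : ℤ) : ℝ) / N) ((((m i : ℤ) : ℝ) + 1) / N) := by
  have hN' : (0 : ℝ) < N := by exact_mod_cast hN
  ext x
  simp only [gridCell, Set.mem_ofPred_eq, Set.mem_pi, Set.mem_univ, forall_const, Set.mem_Ico]
  refine forall_congr' fun i => ?_
  rw [Int.floor_eq_iff, div_le_iff₀ hN', lt_div_iff₀ hN', mul_comm]

theorem gridCell_unique {N : ℕ} {m m' : I → GridIdx N} {x : I → ℝ} (h : x ∈ gridCell N m)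
    (h' : x ∈ gridCell N m') : m = m' := by
  funext i
  exact Subtype.ext ((h i).symm.trans (h' i))

variable [Fintype I]


theorem measurableSet_gridCell {N : ℕ} (hN : 0 < N) (m : I → GridIdx N) :
    MeasurableSet (gridCell N m) := by
  rw [gridCell_eq_pi hN]
  exact MeasurableSet.univ_pi fun i => measurableSet_Ico

theorem volume_gridCell {N : ℕ} (hN : 0 < N) (m : I → GridIdx N) :
    volume (gridCell N m) = ENNReal.ofReal ((1 / N : ℝ) ^ Fintype.card I) := by
  rw [gridCell_eq_pi hN, volume_pi_pi]
  have : ∀ i, volume (Set.Ico (((m i : ℤ) : ℝ) / N) ((((m i : ℤ) : ℝ) + 1) / N)) =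
      ENNReal.ofReal (1 / N) := by
    intro i
    rw [Real.volume_Ico]
    congr 1; ring
  simp only [this, Finset.prod_const, Finset.card_univ]
  rw [ENNReal.ofReal_pow (by positivity)]

variable [DecidableEq I]

/-- The step function with the given values on the grid cells and `0` outside the grid. -/
noncomputable def stepFn (N : ℕ) (f : (I → GridIdx N) → ℝ) (x : I → ℝ) : ℝ :=
  ∑ m, (gridCell N m).indicator (fun _ => f m) x

theorem stepFn_of_mem {N : ℕ} {f : (I → GridIdx N) → ℝ} {x : I → ℝ} {m : I → GridIdx N}
    (h : x ∈ gridCell N m) : stepFn N f x = f m := by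
  rw [stepFn, Finset.sum_eq_single m]
  · exact Set.indicator_of_mem h _
  · intro m' _ hne
    exact Set.indicator_of_notMem (fun h' => hne (gridCell_unique h' h)) _
  · simp

theorem stepFn_of_notMem {N : ℕ} {f : (I → GridIdx N) → ℝ} {x : I → ℝ}
    (h : ∀ m, x ∉ gridCell N m) : stepFn N f x = 0 :=
  Finset.sum_eq_zero fun m _ => Set.indicator_of_notMem (h m) _

theorem stepFn_sub (N : ℕ) (f g : (I → GridIdx N) → ℝ) (x : I → ℝ) :
    stepFn N (f - g) x = stepFn N f x - stepFn N g x := by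
  by_cases h : ∃ m, x ∈ gridCell N m
  · obtain ⟨m, hm⟩ := h
    simp [stepFn_of_mem hm]
  · push Not at h
    simp [stepFn_of_notMem h]

theorem memLp_stepFn {N : ℕ} (hN : 0 < N) (f : (I → GridIdx N) → ℝ) (p : ENNReal) :
    MemLp (stepFn N f) p volume := by
  have : stepFn N f = ∑ m, (gridCell N m).indicator (fun _ => f m) := by
    ext x; simp [stepFn]
  rw [this]
  refine memLp_finsetSum' _ fun m _ => memLp_indicator_const p (measurableSet_gridCell hN m) _ ?_
  right
  rw [volume_gridCell hN]
  exact ENNReal.ofReal_ne_top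

theorem integral_stepFn {N : ℕ} (hN : 0 < N) (f : (I → GridIdx N) → ℝ) :
    ∫ x, stepFn N f x = (1 / N : ℝ) ^ Fintype.card I * ∑ m, f m := by
  unfold stepFn
  rw [integral_finsetSum, Finset.mul_sum]
  · refine Finset.sum_congr rfl fun m _ => ?_
    rw [integral_indicator_const _ (measurableSet_gridCell hN m), Measure.real,
      volume_gridCell hN, ENNReal.toReal_ofReal (by positivity), smul_eq_mul]
  · intro m _
    refine (integrable_indicator_iff (measurableSet_gridCell hN m)).2 ?_
    refine integrableOn_const ?_
    rw [volume_gridCell hN]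
    exact ENNReal.ofReal_ne_top

omit [DecidableEq I] in
theorem eLpNorm_two_eq_sqrt {f : (I → ℝ) → ℝ} (hf : MemLp f 2 volume) :
    eLpNorm f 2 volume = ENNReal.ofReal (Real.sqrt (∫ x, f x ^ 2)) := by
  rw [hf.eLpNorm_eq_integral_rpow_norm (by norm_num) (by norm_num)]
  congr 1
  rw [Real.sqrt_eq_rpow]
  simp

theorem eLpNorm_stepFn {N : ℕ} (hN : 0 < N) (f : (I → GridIdx N) → ℝ) :
    eLpNorm (stepFn N f) 2 volume =
      ENNReal.ofReal (Real.sqrt ((1 / N : ℝ) ^ Fintype.card I) * ‖WithLp.toLp 2 f‖) := by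
  rw [eLpNorm_two_eq_sqrt (memLp_stepFn hN f 2)]
  have : (fun x => stepFn N f x ^ 2) = stepFn N fun m => f m ^ 2 := by
    ext x
    by_cases h : ∃ m, x ∈ gridCell N m
    · obtain ⟨m, hm⟩ := h
      simp [stepFn_of_mem hm]
    · push Not at h
      simp [stepFn_of_notMem h]
  rw [this, integral_stepFn hN, Real.sqrt_mul (by positivity)]
  congr 2
  rw [← Real.sqrt_sq (norm_nonneg (WithLp.toLp 2 f)), EuclideanSpace.real_norm_sq_eq]

omit [DecidableEq I] in
theorem integrable_exp_neg_mul_sum_sq {c : ℝ} (hc : 0 < c) :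
    Integrable fun x : I → ℝ => Real.exp (-c * ∑ i, x i ^ 2) := by
  have : (fun x : I → ℝ => Real.exp (-c * ∑ i, x i ^ 2)) =
      fun x => ∏ i, Real.exp (-c * x i ^ 2) := by
    ext x
    rw [← Real.exp_sum, Finset.mul_sum]
  rw [this]
  exact Integrable.fintype_prod (f := fun _ t => Real.exp (-c * t ^ 2))
    fun _ => integrable_exp_neg_mul_sq hc

theorem abs_floor_div_sub_le {N : ℕ} (hN : 0 < N) (t : ℝ) :
    |(⌊(N : ℝ) * t⌋ : ℝ) / N - t| ≤ 1 / N := by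
  have hN' : (0 : ℝ) < N := by exact_mod_cast hN
  have h1 := Int.floor_le ((N : ℝ) * t)
  have h2 := Int.lt_floor_add_one ((N : ℝ) * t)
  have : (⌊(N : ℝ) * t⌋ : ℝ) / N - t = (⌊(N : ℝ) * t⌋ - N * t) / N := by field_simp
  rw [this, abs_div, abs_of_pos hN']
  gcongr
  rw [abs_le]; constructor <;> linarith

omit [DecidableEq I] in
theorem eventually_exists_mem_gridCell (x : I → ℝ) :
    ∀ᶠ N : ℕ in atTop, ∃ m : I → GridIdx N, x ∈ gridCell N m := by
  have h : ∀ᶠ N : ℕ in atTop, ∀ i, |x i| + 1 ≤ (N : ℝ) := by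
    rw [eventually_all]
    exact fun i => tendsto_natCast_atTop_atTop.eventually_ge_atTop _
  filter_upwards [h] with N hN
  have hmem : ∀ i, ⌊(N : ℝ) * x i⌋ ∈ Finset.Ico (-(N : ℤ) ^ 2) ((N : ℤ) ^ 2) := by
    intro i
    have h1 := abs_le.1 (le_refl |x i|)
    have hN0 : (0 : ℝ) ≤ N := by positivity
    have hpos : (1 : ℝ) ≤ N := le_trans (by linarith [abs_nonneg (x i)]) (hN i)
    rw [Finset.mem_Ico, Int.le_floor, Int.floor_lt]
    push_cast
    constructor <;> nlinarith [hN i]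
  exact ⟨fun i => ⟨_, hmem i⟩, fun i => rfl⟩

/-- Sampling a continuous function with Gaussian decay on finer and finer grids converges
in `L²`. -/
theorem tendsto_eLpNorm_sub_stepFn {f : (I → ℝ) → ℝ} (hf : Continuous f) {C c : ℝ} (hc : 0 < c)
    (hfC : ∀ x, |f x| ≤ C * Real.exp (-c * ∑ i, x i ^ 2)) :
    Tendsto (fun N : ℕ => eLpNorm (fun x => f x - stepFn N (fun m => f (gridPt N m)) x) 2 volume)
      atTop (𝓝 0) := by
  have hC : 0 ≤ C := by
    by_contra h
    have h1 := (abs_nonneg _).trans (hfC 0)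
    have := mul_neg_of_neg_of_pos (not_le.1 h) (Real.exp_pos (-c * ∑ i : I, (0 : I → ℝ) i ^ 2))
    linarith
  set K : ℝ := C + C * Real.exp (c * Fintype.card I) with hK
  have hK0 : 0 ≤ K := by positivity
  -- Moving a point by at most `1` costs no more than halving the rate of decay.
  have hbound : ∀ N : ℕ, 0 < N → ∀ x, |f x - stepFn N (fun m => f (gridPt N m)) x| ≤
      K * Real.exp (-(c / 2) * ∑ i, x i ^ 2) := by
    intro N hN x
    have hsum : 0 ≤ ∑ i, x i ^ 2 := Finset.sum_nonneg fun i _ => sq_nonneg _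
    have h1 : |f x| ≤ C * Real.exp (-(c / 2) * ∑ i, x i ^ 2) := by
      refine (hfC x).trans ?_
      gcongr
      nlinarith
    have h2 : |stepFn N (fun m => f (gridPt N m)) x| ≤
        C * Real.exp (c * Fintype.card I) * Real.exp (-(c / 2) * ∑ i, x i ^ 2) := by
      by_cases h : ∃ m, x ∈ gridCell N m
      · obtain ⟨m, hm⟩ := h
        rw [stepFn_of_mem hm]
        refine (hfC _).trans ?_
        rw [mul_assoc, ← Real.exp_add]
        gcongr
        have hle : ∑ i, (x i ^ 2 / 2 - 1) ≤ ∑ i, gridPt N m i ^ 2 := by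
          refine Finset.sum_le_sum fun i _ => ?_
          have h3 := abs_floor_div_sub_le hN (x i)
          have h4 : (1 : ℝ) / N ≤ 1 := by
            rw [div_le_one (by exact_mod_cast hN)]; exact_mod_cast hN
          have h5 := abs_le.1 (h3.trans h4)
          have h6 : gridPt N m i = (⌊(N : ℝ) * x i⌋ : ℝ) / N := by rw [gridPt, hm i]
          rw [h6]
          set y := (⌊(N : ℝ) * x i⌋ : ℝ) / N
          nlinarith [sq_nonneg (x i - 2 * y)]
        rw [Finset.sum_sub_distrib, ← Finset.sum_div] at hle
        simp only [Finset.sum_const, Finset.card_univ, nsmul_eq_mul, mul_one] at hle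
        nlinarith
      · push Not at h
        rw [stepFn_of_notMem h, abs_zero]
        positivity
    calc _ ≤ |f x| + |stepFn N (fun m => f (gridPt N m)) x| := abs_sub _ _
      _ ≤ _ := by rw [hK, add_mul]; exact add_le_add h1 h2
  have hint : Integrable fun x : I → ℝ => (K * Real.exp (-(c / 2) * ∑ i, x i ^ 2)) ^ 2 := by
    have : (fun x : I → ℝ => (K * Real.exp (-(c / 2) * ∑ i, x i ^ 2)) ^ 2) =
        fun x => K ^ 2 * Real.exp (-c * ∑ i, x i ^ 2) := by
      ext x
      rw [mul_pow, ← Real.exp_nat_mul]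
      congr 2; push_cast; ring
    rw [this]
    exact (integrable_exp_neg_mul_sum_sq hc).const_mul _
  have hmeas : ∀ N : ℕ, 0 < N → AEStronglyMeasurable
      (fun x => f x - stepFn N (fun m => f (gridPt N m)) x) volume := fun N hN =>
    hf.aestronglyMeasurable.sub (memLp_stepFn hN _ 2).aestronglyMeasurable
  have hmem : ∀ N : ℕ, 0 < N →
      MemLp (fun x => f x - stepFn N (fun m => f (gridPt N m)) x) 2 volume := by
    intro N hN
    rw [memLp_two_iff_integrable_sq (hmeas N hN)]
    refine hint.mono' ((hmeas N hN).pow 2) (Eventually.of_forall fun x => ?_)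
    rw [Real.norm_eq_abs, abs_pow]
    exact pow_le_pow_left₀ (abs_nonneg _) (hbound N hN x) 2
  have hlim : Tendsto (fun N : ℕ => ∫ x, (f x - stepFn N (fun m => f (gridPt N m)) x) ^ 2) atTop
      (𝓝 (∫ _ : I → ℝ, (0 : ℝ))) := by
    refine tendsto_integral_filter_of_dominated_convergence _ ?_ ?_ hint ?_
    · filter_upwards [eventually_gt_atTop 0] with N hN using (hmeas N hN).pow 2
    · filter_upwards [eventually_gt_atTop 0] with N hN
      refine Eventually.of_forall fun x => ?_
      rw [Real.norm_eq_abs, abs_pow]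
      exact pow_le_pow_left₀ (abs_nonneg _) (hbound N hN x) 2
    · refine Eventually.of_forall fun x => ?_
      have hpt : Tendsto (fun N : ℕ => fun i => (⌊(N : ℝ) * x i⌋ : ℝ) / N) atTop (𝓝 x) := by
        rw [tendsto_pi_nhds]
        intro i
        rw [tendsto_iff_dist_tendsto_zero]
        refine squeeze_zero' (Eventually.of_forall fun _ => dist_nonneg) ?_
          tendsto_one_div_atTop_nhds_zero_nat
        filter_upwards [eventually_gt_atTop 0] with N hN
        rw [Real.dist_eq]
        exact abs_floor_div_sub_le hN (x i)
      have h1 := (hf.tendsto x).comp hpt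
      have h2 := ((tendsto_const_nhds (x := f x)).sub h1).pow 2
      rw [sub_self, zero_pow two_ne_zero] at h2
      refine h2.congr' ?_
      filter_upwards [eventually_exists_mem_gridCell x] with N hN
      obtain ⟨m, hm⟩ := hN
      rw [stepFn_of_mem hm]
      have : gridPt N m = fun i => (⌊(N : ℝ) * x i⌋ : ℝ) / N := by
        ext i; rw [gridPt, hm i]
      rw [this]; rfl
  rw [integral_zero] at hlim
  have h3 := ENNReal.tendsto_ofReal ((Real.continuous_sqrt.tendsto _).comp hlim)
  rw [Real.sqrt_zero, ENNReal.ofReal_zero] at h3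
  refine h3.congr' ?_
  filter_upwards [eventually_gt_atTop 0] with N hN
  exact (eLpNorm_two_eq_sqrt (hmem N hN)).symm

end Grid

/-! ### Canonical coordinates of a bipartition -/

section Canonical

open Matrix

variable {D : ℕ}

open Classical in
/-- The reflection that changes the sign of the variables outside `A`. -/
noncomputable def signMatrix (A : Set (Fin D)) : Matrix (Fin D) (Fin D) ℝ :=
  Matrix.diagonal fun i => if i ∈ A then 1 else -1

theorem signMatrix_mul_self (A : Set (Fin D)) : signMatrix A * signMatrix A = 1 := by
  rw [signMatrix, diagonal_mul_diagonal, ← diagonal_one]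
  congr 1; ext i
  split_ifs <;> norm_num

theorem signMatrix_transpose (A : Set (Fin D)) : (signMatrix A)ᵀ = signMatrix A :=
  diagonal_transpose _

theorem within_add_across (S : Matrix (Fin D) (Fin D) ℝ) (A : Set (Fin D)) :
    withinBlocks S A + acrossBlocks S A = S := by
  ext i j
  by_cases h : (i ∈ A ↔ j ∈ A) <;> simp [withinBlocks, acrossBlocks, h]

theorem sign_mul_within (S : Matrix (Fin D) (Fin D) ℝ) (A : Set (Fin D)) :
    signMatrix A * withinBlocks S A = withinBlocks S A * signMatrix A := by
  ext i j
  rw [signMatrix, diagonal_mul, mul_diagonal]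
  by_cases hi : i ∈ A <;> by_cases hj : j ∈ A <;> simp [withinBlocks, hi, hj]

theorem sign_mul_across (S : Matrix (Fin D) (Fin D) ℝ) (A : Set (Fin D)) :
    signMatrix A * acrossBlocks S A = -(acrossBlocks S A * signMatrix A) := by
  ext i j
  rw [signMatrix, diagonal_mul, Matrix.neg_apply, mul_diagonal]
  by_cases hi : i ∈ A <;> by_cases hj : j ∈ A <;> simp [acrossBlocks, hi, hj]

theorem sign_conj (S : Matrix (Fin D) (Fin D) ℝ) (A : Set (Fin D)) :
    signMatrix A * S * signMatrix A = withinBlocks S A - acrossBlocks S A := by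
  have h := signMatrix_mul_self A
  conv_lhs => rw [← within_add_across S A]
  rw [mul_add, add_mul, sign_mul_within, sign_mul_across, neg_mul, mul_assoc, mul_assoc, h]
  simp [sub_eq_add_neg]

theorem PosDef.sign_conj {S : Matrix (Fin D) (Fin D) ℝ} (hS : S.PosDef) (A : Set (Fin D)) :
    (withinBlocks S A - acrossBlocks S A).PosDef := by
  have hinj : Function.Injective (signMatrix A).mulVec := by
    apply mulVec_injective_of_isUnit
    exact ⟨⟨_, _, signMatrix_mul_self A, signMatrix_mul_self A⟩, rfl⟩
  have := hS.conjTranspose_mul_mul_same hinj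
  rwa [conjTranspose_eq_transpose_of_trivial, signMatrix_transpose, _root_.sign_conj] at this

theorem posDef_withinBlocks {S : Matrix (Fin D) (Fin D) ℝ} (hS : S.PosDef) (A : Set (Fin D)) :
    (withinBlocks S A).PosDef := by
  have h : withinBlocks S A = (1 / 2 : ℝ) • (S + (withinBlocks S A - acrossBlocks S A)) := by
    conv_rhs => rw [← within_add_across S A]
    ext i j
    simp [withinBlocks, acrossBlocks]
    by_cases h : (i ∈ A ↔ j ∈ A) <;> simp [h]
    ring
  rw [h]
  exact (hS.add (PosDef.sign_conj hS A)).smul (by norm_num)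

theorem across_transpose {S : Matrix (Fin D) (Fin D) ℝ} (hS : S.PosDef) (A : Set (Fin D)) :
    (acrossBlocks S A)ᵀ = acrossBlocks S A := by
  ext i j
  have := hS.isHermitian.apply i j
  simp only [star_trivial] at this
  by_cases hi : i ∈ A <;> by_cases hj : j ∈ A <;> simp [acrossBlocks, hi, hj, this]

theorem Matrix.IsHermitian.exists_diagonalization {M : Matrix (Fin D) (Fin D) ℝ}
    (hM : M.IsHermitian) : ∃ (U : Matrix (Fin D) (Fin D) ℝ) (μ : Fin D → ℝ),
      Uᵀ * U = 1 ∧ Uᵀ * M * U = diagonal μ := by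
  refine ⟨hM.eigenvectorUnitary, hM.eigenvalues, ?_, ?_⟩
  · have := Unitary.coe_star_mul_self hM.eigenvectorUnitary
    rwa [star_eq_conjTranspose, conjTranspose_eq_transpose_of_trivial] at this
  · have h1 := hM.conjStarAlgAut_star_eigenvectorUnitary
    rw [Unitary.conjStarAlgAut_apply] at h1
    simp only [Unitary.coe_star, star_eq_conjTranspose,
      conjTranspose_eq_transpose_of_trivial, transpose_transpose] at h1
    rw [h1]; rfl

/-- The columns of `T` are canonical directions for the bipartition into `A` and its complement:
in the coordinates `Tᵀ x`, the within-block covariance is the identity and the cross-covariance is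
diagonal. Its diagonal entries `μ` are the canonical correlations with both signs. -/
structure IsCanonical (S : Matrix (Fin D) (Fin D) ℝ) (A : Set (Fin D))
    (T : Matrix (Fin D) (Fin D) ℝ) (μ : Fin D → ℝ) : Prop where
  within : Tᵀ * withinBlocks S A * T = 1
  across : Tᵀ * acrossBlocks S A * T = diagonal μ

theorem exists_isCanonical {S : Matrix (Fin D) (Fin D) ℝ} (hS : S.PosDef) (A : Set (Fin D)) :
    ∃ T μ, IsCanonical S A T μ := by
  have hW := posDef_withinBlocks hS A
  obtain ⟨U, l, hU, hl⟩ := hW.isHermitian.exists_diagonalization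
  have hlpos : ∀ i, 0 < l i := by
    have hinj : Function.Injective U.mulVec := by
      apply mulVec_injective_of_isUnit
      exact ⟨⟨U, Uᵀ, mul_eq_one_comm.1 hU, hU⟩, rfl⟩
    have := hW.conjTranspose_mul_mul_same hinj
    rw [conjTranspose_eq_transpose_of_trivial, hl] at this
    exact posDef_diagonal_iff.1 this
  set T₀ := U * diagonal fun i => 1 / Real.sqrt (l i) with hT₀
  have h0 : T₀ᵀ * withinBlocks S A * T₀ = 1 := by
    rw [hT₀, transpose_mul, diagonal_transpose]
    calc _ = diagonal (fun i => 1 / Real.sqrt (l i)) * (Uᵀ * withinBlocks S A * U) *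
          diagonal (fun i => 1 / Real.sqrt (l i)) := by simp only [mul_assoc]
      _ = 1 := by
        rw [hl, diagonal_mul_diagonal, diagonal_mul_diagonal, ← diagonal_one]
        congr 1; ext i
        have := Real.sqrt_pos.2 (hlpos i)
        have h2 := Real.mul_self_sqrt (hlpos i).le
        field_simp
        nlinarith
  clear_value T₀
  have hsymm : (T₀ᵀ * acrossBlocks S A * T₀).IsHermitian := by
    rw [IsHermitian, conjTranspose_eq_transpose_of_trivial, transpose_mul, transpose_mul,
      transpose_transpose, across_transpose hS, mul_assoc]
  obtain ⟨O, μ, hO, hμ⟩ := hsymm.exists_diagonalization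
  refine ⟨T₀ * O, μ, ?_, ?_⟩
  · rw [transpose_mul]
    calc _ = Oᵀ * (T₀ᵀ * withinBlocks S A * T₀) * O := by simp only [mul_assoc]
      _ = 1 := by rw [h0, mul_one, hO]
  · rw [transpose_mul, ← hμ]; simp only [mul_assoc]

variable {S T : Matrix (Fin D) (Fin D) ℝ} {A : Set (Fin D)} {μ : Fin D → ℝ}

theorem IsCanonical.conj (h : IsCanonical S A T μ) : Tᵀ * S * T = diagonal fun j => 1 + μ j := by
  conv_lhs => rw [← within_add_across S A]
  rw [mul_add, add_mul, h.within, h.across, ← diagonal_one, diagonal_add]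

theorem IsCanonical.det_ne_zero (h : IsCanonical S A T μ) : T.det ≠ 0 := by
  intro h0
  have := congrArg Matrix.det h.within
  simp [h0] at this

theorem IsCanonical.isUnit (h : IsCanonical S A T μ) : IsUnit T :=
  (Matrix.isUnit_iff_isUnit_det T).2 h.det_ne_zero.isUnit

theorem IsCanonical.abs_lt_one (h : IsCanonical S A T μ) (hS : S.PosDef) (j : Fin D) :
    |μ j| < 1 := by
  have hinj : Function.Injective T.mulVec := mulVec_injective_of_isUnit h.isUnit
  have h1 := hS.conjTranspose_mul_mul_same hinj
  rw [conjTranspose_eq_transpose_of_trivial, h.conj] at h1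
  have h2 := (PosDef.sign_conj hS A).conjTranspose_mul_mul_same hinj
  rw [conjTranspose_eq_transpose_of_trivial, mul_sub, sub_mul, h.within, h.across, ← diagonal_one,
    diagonal_sub] at h2
  have h1' := posDef_diagonal_iff.1 h1 j
  have h2' := posDef_diagonal_iff.1 h2 j
  rw [abs_lt]; constructor <;> linarith

theorem IsCanonical.mul_transpose_mul_within (h : IsCanonical S A T μ) :
    T * Tᵀ * withinBlocks S A = 1 := by
  have h1 := mul_eq_one_comm.1 h.within
  rw [mul_assoc]; exact h1

theorem IsCanonical.inv_eq (h : IsCanonical S A T μ) (hS : S.PosDef) :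
    S⁻¹ = T * diagonal (fun j => (1 + μ j)⁻¹) * Tᵀ := by
  refine inv_eq_right_inv ?_
  have h1 := h.conj
  have hne : ∀ j, 1 + μ j ≠ 0 := fun j => by
    have := (abs_lt.1 (h.abs_lt_one hS j)).1; linarith
  have h2 : Tᵀ * (S * (T * diagonal (fun j => (1 + μ j)⁻¹) * Tᵀ)) = Tᵀ * 1 := by
    calc _ = (Tᵀ * S * T) * diagonal (fun j => (1 + μ j)⁻¹) * Tᵀ := by simp only [mul_assoc]
      _ = _ := by
        rw [h1, diagonal_mul_diagonal]
        simp [hne]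
  have hu : IsUnit Tᵀ := by
    rw [Matrix.isUnit_iff_isUnit_det, det_transpose]; exact h.det_ne_zero.isUnit
  exact hu.mul_left_cancel h2

theorem IsCanonical.quadratic_eq (h : IsCanonical S A T μ) (hS : S.PosDef) (x : Fin D → ℝ) :
    x ⬝ᵥ S⁻¹.mulVec x = ∑ j, (1 + μ j)⁻¹ * (Tᵀ *ᵥ x) j ^ 2 := by
  rw [h.inv_eq hS, ← mulVec_mulVec, ← mulVec_mulVec, dotProduct_mulVec, ← mulVec_transpose,
    dotProduct]
  refine Finset.sum_congr rfl fun j _ => ?_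
  rw [mulVec_diagonal]; ring

/-- Reflecting the variables outside `A` exchanges the canonical directions of opposite canonical
correlations. -/
theorem IsCanonical.sum_sign (h : IsCanonical S A T μ) (φ : ℝ → ℝ) (x : Fin D → ℝ) :
    ∑ j, φ (μ j) * (Tᵀ *ᵥ (signMatrix A *ᵥ x)) j ^ 2 = ∑ j, φ (-μ j) * (Tᵀ *ᵥ x) j ^ 2 := by
  set J := signMatrix A with hJ
  set W := withinBlocks S A
  set C := acrossBlocks S A
  set O := Tᵀ * J * (W * T) with hO
  have hWT : W * (T * Tᵀ) = 1 := mul_eq_one_comm.1 h.mul_transpose_mul_within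
  have hTW : T * Tᵀ * W = 1 := h.mul_transpose_mul_within
  have hy : Tᵀ *ᵥ (J *ᵥ x) = O *ᵥ (Tᵀ *ᵥ x) := by
    rw [mulVec_mulVec, mulVec_mulVec, hO]
    congr 1
    calc Tᵀ * J = Tᵀ * J * (W * (T * Tᵀ)) := by rw [hWT, mul_one]
      _ = _ := by simp only [mul_assoc]
  have hWsymm : Wᵀ = W := by
    have h1 : (T * Tᵀ)ᵀ = T * Tᵀ := by rw [transpose_mul, transpose_transpose]
    have h2 : Wᵀ * (T * Tᵀ) = 1 := by
      rw [← h1, ← transpose_mul, hTW, transpose_one]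
    calc Wᵀ = Wᵀ * (T * Tᵀ * W) := by rw [hTW, mul_one]
      _ = (Wᵀ * (T * Tᵀ)) * W := by simp only [mul_assoc]
      _ = W := by rw [h2, one_mul]
  have hOsymm : Oᵀ = O := by
    rw [hO, transpose_mul, transpose_mul, transpose_mul, transpose_transpose,
      hJ, signMatrix_transpose, hWsymm]
    have := sign_mul_within S A
    calc _ = Tᵀ * (W * signMatrix A) * T := by simp only [mul_assoc]
      _ = _ := by rw [← this]; simp only [mul_assoc]; rfl
  have hOO : O * O = 1 := by
    calc O * O = Tᵀ * J * (W * (T * Tᵀ)) * J * W * T := by rw [hO]; simp only [mul_assoc]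
      _ = Tᵀ * (J * J) * W * T := by rw [hWT]; simp only [mul_assoc, one_mul]
      _ = 1 := by rw [hJ, signMatrix_mul_self, mul_one]; exact h.within
  have hcomm : diagonal μ * O = -(O * diagonal μ) := by
    rw [← h.across]
    calc Tᵀ * C * T * O = Tᵀ * C * (T * Tᵀ) * (J * W) * T := by rw [hO]; simp only [mul_assoc]
      _ = Tᵀ * C * (T * Tᵀ * W) * J * T := by
        rw [hJ, sign_mul_within S A]; simp only [mul_assoc]; rfl
      _ = Tᵀ * (C * J) * T := by rw [hTW]; simp only [mul_assoc, mul_one]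
      _ = -(Tᵀ * (J * C) * T) := by rw [hJ, sign_mul_across]; simp; rfl
      _ = -(Tᵀ * J * (W * (T * Tᵀ)) * C * T) := by rw [hWT, mul_one]; simp only [mul_assoc]
      _ = _ := by rw [hO]; simp only [mul_assoc]; rfl
  have hφ : diagonal (fun j => φ (μ j)) * O = O * diagonal fun j => φ (-μ j) := by
    ext i j
    rw [diagonal_mul, mul_diagonal]
    have h1 := congrFun (congrFun hcomm i) j
    rw [diagonal_mul, Matrix.neg_apply, mul_diagonal] at h1
    by_cases hz : O i j = 0
    · simp [hz]
    · have h2 : μ i = -μ j := mul_right_cancel₀ hz (by linarith)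
      rw [h2, mul_comm]
  have hquad : ∀ (d y : Fin D → ℝ), ∑ j, d j * y j ^ 2 = y ⬝ᵥ (diagonal d *ᵥ y) := by
    intro d y
    rw [dotProduct]
    refine Finset.sum_congr rfl fun j _ => ?_
    rw [mulVec_diagonal]; ring
  rw [hy, hquad, hquad]
  generalize Tᵀ *ᵥ x = y
  clear_value O
  rw [mulVec_mulVec, hφ, ← mulVec_mulVec]
  conv_lhs => rw [dotProduct_mulVec, ← mulVec_transpose, hOsymm, mulVec_mulVec, hOO, one_mulVec]

/-- The reflected canonical directions are canonical for the opposite correlations. -/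
theorem IsCanonical.neg (h : IsCanonical S A T μ) :
    IsCanonical S A (signMatrix A * T) fun j => -μ j := by
  constructor
  · rw [transpose_mul, signMatrix_transpose]
    calc _ = Tᵀ * (signMatrix A * withinBlocks S A) * (signMatrix A * T) := by
          simp only [mul_assoc]
      _ = Tᵀ * withinBlocks S A * (signMatrix A * signMatrix A) * T := by
          rw [sign_mul_within]; simp only [mul_assoc]
      _ = 1 := by rw [signMatrix_mul_self, mul_one, h.within]
  · rw [transpose_mul, signMatrix_transpose]
    calc _ = Tᵀ * (signMatrix A * acrossBlocks S A) * (signMatrix A * T) := by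
          simp only [mul_assoc]
      _ = -(Tᵀ * acrossBlocks S A * (signMatrix A * signMatrix A) * T) := by
          rw [sign_mul_across]; simp only [mul_assoc, neg_mul, mul_neg]
      _ = _ := by rw [signMatrix_mul_self, mul_one, h.across, diagonal_neg]

open Polynomial in
theorem IsCanonical.roots_eq (h : IsCanonical S A T μ) :
    (canonicalPoly S A).roots = Finset.univ.val.map μ := by
  have hdet : Polynomial.C (T.det ^ 2) * canonicalPoly S A = ∏ j, (X - Polynomial.C (μ j)) := by
    have h1 : (Tᵀ).map Polynomial.C * ((X : Polynomial ℝ) • (withinBlocks S A).map Polynomial.C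
        - (acrossBlocks S A).map Polynomial.C) * T.map Polynomial.C =
        diagonal fun j => X - Polynomial.C (μ j) := by
      rw [mul_sub, sub_mul, Matrix.mul_smul, Matrix.smul_mul, ← Matrix.map_mul, ← Matrix.map_mul,
        ← Matrix.map_mul, ← Matrix.map_mul, h.within, h.across]
      ext i j
      by_cases hij : i = j
      · subst hij; simp
      · simp [hij]
    have h2 := congrArg Matrix.det h1
    rw [det_mul, det_mul, det_diagonal] at h2
    have h3 : (T.map Polynomial.C).det = Polynomial.C T.det :=
      (RingHom.map_det Polynomial.C T).symm
    have h4 : ((Tᵀ).map Polynomial.C).det = Polynomial.C T.det := by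
      rw [← det_transpose T]; exact (RingHom.map_det Polynomial.C Tᵀ).symm
    rw [h3, h4] at h2
    rw [← h2, canonicalPoly, pow_two, Polynomial.C_mul]; ring
  rw [← Polynomial.roots_C_mul _ (pow_ne_zero 2 h.det_ne_zero), hdet]
  exact Polynomial.roots_multiset_prod_X_sub_C (Finset.univ.val.map μ) ▸ by
    rw [Multiset.map_map]; rfl

end Canonical

/-! ### Summing over the canonical correlations -/

section Correlations

/-- A bound on the products `∏ 1 / (1 - s ^ k)` over positive integers `k`. -/
noncomputable def correlationConst (s : ℝ) : ℝ := Real.exp (s / (1 - s) ^ 2)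

theorem one_le_correlationConst {s : ℝ} (hs : 0 < s) : 1 ≤ correlationConst s :=
  Real.one_le_exp (by positivity)

theorem prod_inv_one_sub_le {s : ℝ} (hs : 0 < s) (hs1 : s < 1) {n : ℕ} (F : ℕ → ℝ)
    (hF0 : ∀ k, 0 ≤ F k) (hF : ∀ k < n, F k ≤ (1 - s ^ (k + 1))⁻¹) :
    ∏ k ∈ Finset.range n, F k ≤ correlationConst s := by
  have h1s : 0 < 1 - s := by linarith
  have hfactor : ∀ k, (1 - s ^ (k + 1))⁻¹ ≤ Real.exp (s ^ (k + 1) / (1 - s)) := by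
    intro k
    have hle : s ^ (k + 1) ≤ s := pow_le_of_le_one hs.le hs1.le (by omega)
    have hpos : 0 < s ^ (k + 1) := by positivity
    generalize s ^ (k + 1) = t at *
    have h1t : 0 < 1 - t := by linarith
    have h2 := Real.add_one_le_exp (t / (1 - s))
    refine le_trans ?_ h2
    rw [inv_le_iff_one_le_mul₀ h1t, ← sub_nonneg]
    have : (t / (1 - s) + 1) * (1 - t) - 1 = t * (s - t) / (1 - s) := by
      field_simp; ring
    rw [this]
    exact div_nonneg (mul_nonneg hpos.le (by linarith)) h1s.le
  calc ∏ k ∈ Finset.range n, F k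
      ≤ ∏ k ∈ Finset.range n, Real.exp (s ^ (k + 1) / (1 - s)) :=
        Finset.prod_le_prod (fun k _ => hF0 k) fun k hk =>
          (hF k (Finset.mem_range.1 hk)).trans (hfactor k)
    _ = Real.exp (∑ k ∈ Finset.range n, s ^ (k + 1) / (1 - s)) := (Real.exp_sum _ _).symm
    _ ≤ correlationConst s := by
      unfold correlationConst
      gcongr
      have h3 := (summable_geometric_of_lt_one hs.le hs1).sum_le_tsum (Finset.range n)
        (fun k _ => by positivity)
      rw [tsum_geometric_of_lt_one hs.le hs1] at h3
      calc ∑ k ∈ Finset.range n, s ^ (k + 1) / (1 - s)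
          = s / (1 - s) * ∑ k ∈ Finset.range n, s ^ k := by
            rw [Finset.mul_sum]; exact Finset.sum_congr rfl fun k _ => by rw [pow_succ]; ring
        _ ≤ s / (1 - s) * (1 - s)⁻¹ := by gcongr
        _ = _ := by field_simp

variable {D : ℕ} {S T : Matrix (Fin D) (Fin D) ℝ} {A : Set (Fin D)} {μ : Fin D → ℝ}

/-- Both signs of each canonical correlation occur, so that a product over all of them is the
square of the product over the positive ones. -/
theorem IsCanonical.prod_inv_le (h : IsCanonical S A T μ) (hS : S.PosDef) {s : ℝ} (hs : 0 < s)
    (hs1 : s < 1) (hcorr : ∀ j, canonicalCorr S A j ≤ (s ^ (j + 1)) ^ 2) :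
    ∏ j, (1 - Real.sqrt |μ j|)⁻¹ ≤ correlationConst s ^ 2 := by
  classical
  set F : ℝ → ℝ := fun t => (1 - Real.sqrt (max t 0))⁻¹ with hF
  have hF0 : ∀ t, t < 1 → 0 ≤ F t := by
    intro t ht
    have : Real.sqrt (max t 0) ≤ 1 := by
      exact Real.sqrt_le_one.2 (max_le ht.le zero_le_one)
    exact inv_nonneg.2 (by linarith)
  have hsplit : ∀ j, (1 - Real.sqrt |μ j|)⁻¹ = F (μ j) * F (-μ j) := by
    intro j
    rcases le_total 0 (μ j) with h0 | h0
    · simp [hF, abs_of_nonneg h0, h0]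
    · simp [hF, abs_of_nonpos h0, h0]
  have hprod : ∀ ν : Fin D → ℝ, ∏ j, F (ν j) = ((Finset.univ.val.map ν).map F).prod := by
    intro ν; rw [Multiset.map_map]; rfl
  have hroots : (Finset.univ.val.map fun j => -μ j) = (canonicalPoly S A).roots :=
    h.neg.roots_eq.symm
  have hone : ∏ j, F (μ j) ≤ correlationConst s := by
    set l := canonicalCorrList S A with hl
    have h1 : ∏ j, F (μ j) = (l.map F).prod := by
      rw [hprod, ← h.roots_eq]
      conv_lhs => rw [← Multiset.filter_add_not (fun t : ℝ => 0 < t) (canonicalPoly S A).roots]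
      rw [Multiset.map_add, Multiset.prod_add]
      have h2 : ((Multiset.filter (fun t : ℝ => ¬ 0 < t) (canonicalPoly S A).roots).map F).prod
          = 1 := by
        refine Multiset.prod_eq_one fun t ht => ?_
        obtain ⟨t, ht', rfl⟩ := Multiset.mem_map.1 ht
        have := (Multiset.mem_filter.1 ht').2
        simp [hF, not_lt.1 this]
      rw [h2, mul_one, ← Multiset.prod_coe, ← Multiset.map_coe, hl, canonicalCorrList,
        Multiset.sort_eq]
    have hlmem : ∀ t ∈ l, t < 1 := by
      intro t ht
      have h2 : t ∈ (canonicalPoly S A).roots := by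
        have := (Multiset.mem_sort _).1 ht
        exact (Multiset.mem_filter.1 this).1
      rw [h.roots_eq] at h2
      obtain ⟨j, -, rfl⟩ := Multiset.mem_map.1 h2
      exact (abs_lt.1 (h.abs_lt_one hS j)).2
    have h2 : (l.map F).prod = ∏ k ∈ Finset.range l.length, F (l.getD k 0) := by
      rw [Finset.prod_range, ← List.prod_ofFn]
      congr 1
      refine List.ext_getElem (by simp) fun k hk hk' => ?_
      have : k < l.length := by simpa using hk
      simp
    rw [h1, h2]
    refine prod_inv_one_sub_le hs hs1 _ (fun k => hF0 _ ?_) fun k hk => ?_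
    · by_cases hk : k < l.length
      · rw [List.getD_eq_getElem _ _ hk]; exact hlmem _ (List.getElem_mem hk)
      · rw [List.getD_eq_default _ _ (by omega)]; exact zero_lt_one
    · have h3 : max (l.getD k 0) 0 ≤ (s ^ (k + 1)) ^ 2 := max_le (hcorr k) (by positivity)
      have h4 : Real.sqrt (max (l.getD k 0) 0) ≤ s ^ (k + 1) :=
        Real.sqrt_le_iff.2 ⟨by positivity, h3⟩
      have h5 : s ^ (k + 1) < 1 := pow_lt_one₀ hs.le hs1 (by omega)
      exact inv_anti₀ (by linarith) (by linarith)
  have htwo : ∏ j, F (-μ j) = ∏ j, F (μ j) := by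
    rw [hprod, hprod μ, hroots, h.roots_eq]
  simp only [hsplit]
  rw [Finset.prod_mul_distrib, htwo, ← pow_two]
  exact pow_le_pow_left₀ (Finset.prod_nonneg fun j _ =>
    hF0 _ (abs_lt.1 (h.abs_lt_one hS j)).2) hone 2

end Correlations

/-! ### Truncating a product of exponential series -/

section Truncation

open Filter Topology

variable {J : Type*} [Fintype J] [DecidableEq J]

/-- Of the multi-indices, keep those whose weight `∏ r j ^ n j` is at least `δ`. There are few of
them because the weights are summable, and what is left out of the exponential series is small
because each term carries its weight as a factor. -/
theorem exists_truncation {r : J → ℝ} (hr0 : ∀ j, 0 ≤ r j) (hr1 : ∀ j, r j < 1) {δ : ℝ}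
    (hδ : 0 < δ) :
    ∃ s : Finset (J → ℕ), (s.card : ℝ) ≤ (∏ j, (1 - r j)⁻¹) / δ ∧
      ∀ z : J → ℝ, |Real.exp (∑ j, r j * z j) -
          ∑ n ∈ s, ∏ j, (r j * z j) ^ n j / (n j).factorial| ≤
        δ * Real.exp (∑ j, |z j|) := by
  have hM : ∀ᶠ M in atTop, ∀ j, r j ^ M < δ := by
    rw [eventually_all]
    exact fun j => (tendsto_pow_atTop_nhds_zero_of_lt_one (hr0 j) (hr1 j)).eventually_lt_const hδ
  obtain ⟨M, hM⟩ := hM.exists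
  let box : ℕ → Finset (J → ℕ) := fun L => Fintype.piFinset fun _ => Finset.range L
  let wt : (J → ℕ) → ℝ := fun n => ∏ j, r j ^ n j
  have hwt0 : ∀ n, 0 ≤ wt n := fun n => Finset.prod_nonneg fun j _ => pow_nonneg (hr0 j) _
  set s := (box M).filter fun n => δ ≤ wt n with hs
  have hsmall : ∀ n, n ∉ s → wt n ≤ δ := by
    intro n hn
    by_cases hb : n ∈ box M
    · have : ¬ δ ≤ wt n := fun h => hn (Finset.mem_filter.2 ⟨hb, h⟩)
      exact (not_le.1 this).le
    · simp only [box, Fintype.mem_piFinset, Finset.mem_range, not_forall, not_lt] at hb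
      obtain ⟨j, hj⟩ := hb
      have h1 : wt n ≤ r j ^ n j := by
        simp only [wt]
        rw [← Finset.mul_prod_erase _ _ (Finset.mem_univ j)]
        refine mul_le_of_le_one_right (pow_nonneg (hr0 j) _) ?_
        exact Finset.prod_le_one (fun i _ => pow_nonneg (hr0 i) _)
          fun i _ => pow_le_one₀ (hr0 i) (hr1 i).le
      exact h1.trans ((pow_le_pow_of_le_one (hr0 j) (hr1 j).le hj).trans (hM j).le)
  refine ⟨s, ?_, fun z => ?_⟩
  · rw [le_div_iff₀ hδ]
    calc (s.card : ℝ) * δ = ∑ n ∈ s, δ := by simp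
      _ ≤ ∑ n ∈ s, wt n := Finset.sum_le_sum fun n hn => (Finset.mem_filter.1 hn).2
      _ ≤ ∑ n ∈ box M, wt n :=
        Finset.sum_le_sum_of_subset_of_nonneg (Finset.filter_subset _ _) fun n _ _ => hwt0 n
      _ = ∏ j, ∑ k ∈ Finset.range M, r j ^ k := by
        rw [Finset.prod_univ_sum]
      _ ≤ _ := by
        refine Finset.prod_le_prod (fun j _ => Finset.sum_nonneg fun k _ => pow_nonneg (hr0 j) _)
          fun j _ => ?_
        rw [← tsum_geometric_of_lt_one (hr0 j) (hr1 j)]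
        exact (summable_geometric_of_lt_one (hr0 j) (hr1 j)).sum_le_tsum _
          fun k _ => pow_nonneg (hr0 j) _
  · set t : (J → ℕ) → ℝ := fun n => ∏ j, (r j * z j) ^ n j / (n j).factorial with ht
    have hexp : ∀ y : ℝ, Tendsto (fun L => ∑ k ∈ Finset.range L, y ^ k / k.factorial) atTop
        (𝓝 (Real.exp y)) := by
      intro y
      rw [Real.exp_eq_exp_ℝ]
      exact (NormedSpace.expSeries_div_hasSum_exp y).tendsto_sum_nat
    have hlim : Tendsto (fun L => ∑ n ∈ box L, t n) atTop (𝓝 (Real.exp (∑ j, r j * z j))) := by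
      rw [Real.exp_sum]
      have := tendsto_finsetProd (Finset.univ : Finset J) fun j _ => hexp (r j * z j)
      refine this.congr fun L => ?_
      rw [Finset.prod_univ_sum]
    have hterm : ∀ n, n ∉ s → |t n| ≤ δ * ∏ j, |z j| ^ n j / (n j).factorial := by
      intro n hn
      have h1 : |t n| = wt n * ∏ j, |z j| ^ n j / (n j).factorial := by
        simp only [ht, wt]
        rw [Finset.abs_prod, ← Finset.prod_mul_distrib]
        refine Finset.prod_congr rfl fun j _ => ?_
        rw [abs_div, abs_pow, abs_mul, abs_of_nonneg (hr0 j), mul_pow, Nat.abs_cast]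
        ring
      rw [h1]
      exact mul_le_mul_of_nonneg_right (hsmall n hn)
        (Finset.prod_nonneg fun j _ => by positivity)
    refine le_of_tendsto ((hlim.sub_const _).abs) ?_
    filter_upwards [eventually_ge_atTop M] with L hL
    have hsub : s ⊆ box L := by
      intro n hn
      have := (Finset.mem_filter.1 hn).1
      simp only [box, Fintype.mem_piFinset, Finset.mem_range] at this ⊢
      exact fun j => (this j).trans_le hL
    have hdiff : ∑ n ∈ box L, t n - ∑ n ∈ s, t n = ∑ n ∈ box L \ s, t n := by
      rw [← Finset.sum_sdiff hsub]; ring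
    rw [hdiff]
    calc |∑ n ∈ box L \ s, t n| ≤ ∑ n ∈ box L \ s, |t n| := Finset.abs_sum_le_sum_abs _ _
      _ ≤ ∑ n ∈ box L \ s, δ * ∏ j, |z j| ^ n j / (n j).factorial :=
        Finset.sum_le_sum fun n hn => hterm n (Finset.mem_sdiff.1 hn).2
      _ ≤ ∑ n ∈ box L, δ * ∏ j, |z j| ^ n j / (n j).factorial :=
        Finset.sum_le_sum_of_subset_of_nonneg Finset.sdiff_subset fun n _ _ =>
          mul_nonneg hδ.le (Finset.prod_nonneg fun j _ => by positivity)
      _ = δ * ∏ j, ∑ k ∈ Finset.range L, |z j| ^ k / k.factorial := by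
        rw [← Finset.mul_sum, Finset.prod_univ_sum]
      _ ≤ δ * Real.exp (∑ j, |z j|) := by
        rw [Real.exp_sum]
        refine mul_le_mul_of_nonneg_left ?_ hδ.le
        exact Finset.prod_le_prod (fun j _ => Finset.sum_nonneg fun k _ => by positivity)
          fun j _ => Real.sum_le_exp_of_nonneg (abs_nonneg _) L

end Truncation

/-! ### Low-rank approximation of a Gaussian across a bipartition -/

section Gaussian

open Matrix

theorem hasRankLE_of_finset_sum {I ι κ : Type*} {χ : ℕ} {A : Set I} {f : (I → ι) → ℝ}
    (s : Finset κ) (hs : s.card ≤ χ) (u g : κ → (I → ι) → ℝ) (hu : ∀ n, DependsOn (u n) A)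
    (hg : ∀ n, DependsOn (g n) Aᶜ) (hf : ∀ x, f x = ∑ n ∈ s, u n x * g n x) :
    HasRankLE χ A f := by
  classical
  obtain ⟨e⟩ : Nonempty (s ↪ Fin χ) := Function.Embedding.nonempty_of_card_le (by simpa)
  have hdep : ∀ (B : Set I) (v : κ → (I → ι) → ℝ), (∀ n, DependsOn (v n) B) →
      ∀ j, DependsOn (Function.extend e (fun n : s => v n) (fun _ _ => 0) j) B := by
    intro B v hv j
    by_cases hj : ∃ n, e n = j
    · obtain ⟨n, rfl⟩ := hj
      rw [e.injective.extend_apply]; exact hv n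
    · rw [Function.extend_apply' _ _ _ hj]
      intro _ _ _; rfl
  refine ⟨_, _, hdep A u hu, hdep Aᶜ g hg, fun x => ?_⟩
  rw [hf, ← Finset.sum_coe_sort s]
  refine Fintype.sum_of_injective e e.injective _ _ (fun j hj => ?_) fun n => ?_
  · rw [Function.extend_apply' _ _ _ (by simpa using hj)]; simp
  · rw [e.injective.extend_apply, e.injective.extend_apply]

variable {D : ℕ} {S T : Matrix (Fin D) (Fin D) ℝ} {A : Set (Fin D)} {μ : Fin D → ℝ}

theorem IsCanonical.exists_le_sum (h : IsCanonical S A T μ) {d : Fin D → ℝ} (hd : ∀ j, 0 < d j) :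
    ∃ c : ℝ, 0 < c ∧ ∀ x : Fin D → ℝ, c * ∑ i, x i ^ 2 ≤ ∑ j, d j * (Tᵀ *ᵥ x) j ^ 2 := by
  set B := withinBlocks S A * T with hB
  have hBT : B * Tᵀ = 1 := by
    rw [hB, mul_assoc]; exact mul_eq_one_comm.1 h.mul_transpose_mul_within
  set b : ℝ := ∑ i, ∑ j, B i j ^ 2
  have hb : 0 ≤ b := Finset.sum_nonneg fun i _ => Finset.sum_nonneg fun j _ => sq_nonneg _
  set e : ℝ := ∑ j, (d j)⁻¹
  have he : 0 ≤ e := Finset.sum_nonneg fun j _ => (inv_pos.2 (hd j)).le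
  refine ⟨1 / (b * e + 1), by positivity, fun x => ?_⟩
  set y := Tᵀ *ᵥ x with hy
  set Q := ∑ j, d j * y j ^ 2
  have hQ : 0 ≤ Q := Finset.sum_nonneg fun j _ => mul_nonneg (hd j).le (sq_nonneg _)
  have hx : x = B *ᵥ y := by rw [hy, mulVec_mulVec, hBT, one_mulVec]
  have h1 : ∑ i, x i ^ 2 ≤ b * ∑ j, y j ^ 2 := by
    rw [Finset.sum_mul]
    refine Finset.sum_le_sum fun i _ => ?_
    have : x i = ∑ j, B i j * y j := congrFun hx i
    rw [this]
    exact Finset.sum_mul_sq_le_sq_mul_sq _ _ _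
  have h2 : ∑ j, y j ^ 2 ≤ e * Q := by
    rw [Finset.sum_mul]
    refine Finset.sum_le_sum fun j _ => ?_
    have h3 : d j * y j ^ 2 ≤ Q := Finset.single_le_sum (f := fun j => d j * y j ^ 2)
      (fun j _ => mul_nonneg (hd j).le (sq_nonneg _)) (Finset.mem_univ j)
    rw [inv_mul_eq_div, le_div_iff₀ (hd j)]
    linarith
  have h4 : ∑ i, x i ^ 2 ≤ b * (e * Q) := h1.trans (mul_le_mul_of_nonneg_left h2 hb)
  rw [div_mul_eq_mul_div, one_mul, div_le_iff₀ (by positivity)]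
  nlinarith

theorem integral_exp_neg_quadratic (hT : T.det ≠ 0) (d : Fin D → ℝ) :
    ∫ x : Fin D → ℝ, Real.exp (-(1 / 2) * ∑ j, d j * (Tᵀ *ᵥ x) j ^ 2) =
      |T.det|⁻¹ * ∏ j, Real.sqrt (2 * Real.pi / d j) := by
  have hT' : Tᵀ.det ≠ 0 := by rwa [det_transpose]
  have h1 := Real.map_matrix_volume_pi_eq_smul_volume_pi hT'
  set F : (Fin D → ℝ) → ℝ := fun y => Real.exp (-(1 / 2) * ∑ j, d j * y j ^ 2) with hF
  have hFc : Continuous F := by fun_prop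
  have hmeas : Measurable (Matrix.toLin' Tᵀ) :=
    (LinearMap.continuous_on_pi (Matrix.toLin' Tᵀ)).measurable
  have h2 : ∫ x, F (Tᵀ *ᵥ x) = ∫ y, F y ∂(Measure.map (Matrix.toLin' Tᵀ) volume) := by
    rw [integral_map hmeas.aemeasurable hFc.aestronglyMeasurable]
    rfl
  have h3 : ∫ y, F y = ∏ j, Real.sqrt (2 * Real.pi / d j) := by
    have : F = fun y => ∏ j, Real.exp (-(d j / 2) * y j ^ 2) := by
      ext y
      simp only [hF, ← Real.exp_sum, Finset.mul_sum]
      congr 1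
      exact Finset.sum_congr rfl fun j _ => by ring
    rw [this, integral_fintype_prod_volume_eq_prod fun j t => Real.exp (-(d j / 2) * t ^ 2)]
    refine Finset.prod_congr rfl fun j _ => ?_
    rw [integral_gaussian]
    congr 1
    rw [div_div_eq_mul_div, mul_comm]
  change ∫ x, F (Tᵀ *ᵥ x) = _
  rw [h2, h1, integral_smul_measure, h3, det_transpose, ENNReal.toReal_ofReal (abs_nonneg _),
    smul_eq_mul, abs_inv]

/-- The normalisation of the square root of the density. -/
noncomputable def rootConst (S : Matrix (Fin D) (Fin D) ℝ) : ℝ :=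
  Real.sqrt (1 / Real.sqrt ((2 * Real.pi) ^ D * S.det))

theorem IsCanonical.sqrt_normalDensity (h : IsCanonical S A T μ) (hS : S.PosDef)
    (x : Fin D → ℝ) : Real.sqrt (normalDensity S x) =
      rootConst S * Real.exp (-(1 / 4) * ∑ j, (1 + μ j)⁻¹ * (Tᵀ *ᵥ x) j ^ 2) := by
  rw [normalDensity, Real.sqrt_mul (by positivity), h.quadratic_eq hS, rootConst]
  congr 1
  rw [Real.sqrt_eq_iff_eq_sq (Real.exp_pos _).le (Real.exp_pos _).le, ← Real.exp_nat_mul]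
  congr 1
  push_cast; ring

theorem continuous_sqrt_normalDensity (S : Matrix (Fin D) (Fin D) ℝ) :
    Continuous fun x => Real.sqrt (normalDensity S x) := by
  unfold normalDensity
  fun_prop

/-- The square root of a normal density decays like a Gaussian. -/
theorem exists_sqrt_normalDensity_le (hS : S.PosDef) : ∃ C c : ℝ, 0 < c ∧ ∀ x,
    |Real.sqrt (normalDensity S x)| ≤ C * Real.exp (-c * ∑ i, x i ^ 2) := by
  obtain ⟨T, μ, h⟩ := exists_isCanonical hS Set.univ
  obtain ⟨c, hc, hle⟩ := h.exists_le_sum (d := fun j => (1 + μ j)⁻¹) fun j =>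
    inv_pos.2 (by have := (abs_lt.1 (h.abs_lt_one hS j)).1; linarith)
  refine ⟨rootConst S, c / 4, by positivity, fun x => ?_⟩
  rw [abs_of_nonneg (Real.sqrt_nonneg _), h.sqrt_normalDensity hS]
  refine mul_le_mul_of_nonneg_left (Real.exp_le_exp.2 ?_) (Real.sqrt_nonneg _)
  have := hle x
  linarith

theorem IsCanonical.det_sq_mul_det (h : IsCanonical S A T μ) :
    T.det ^ 2 * S.det = ∏ j, (1 + μ j) := by
  have := congrArg Matrix.det h.conj
  rw [det_mul, det_mul, det_transpose, det_diagonal] at this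
  rw [← this]; ring

/-- The Gaussian that dominates the truncation error has bounded norm, independently of the
dimension. -/
theorem IsCanonical.rootConst_sq_mul_le (h : IsCanonical S A T μ) (hS : S.PosDef) :
    rootConst S ^ 2 * (|T.det|⁻¹ * ∏ j, Real.sqrt (2 * Real.pi /
      ((1 - μ j ^ 2)⁻¹ * (1 - Real.sqrt |μ j|)))) ≤ ∏ j, (1 - Real.sqrt |μ j|)⁻¹ := by
  have hpi := Real.pi_pos
  have hμ : ∀ j, 0 < 1 + μ j := fun j => by
    have := (abs_lt.1 (h.abs_lt_one hS j)).1; linarith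
  have hdet : Real.sqrt ((2 * Real.pi) ^ D * S.det) * |T.det| =
      ∏ j, Real.sqrt (2 * Real.pi * (1 + μ j)) := by
    rw [← Real.sqrt_sq_eq_abs, ← Real.sqrt_mul (by have := hS.det_pos; positivity), mul_assoc,
      mul_comm S.det, h.det_sq_mul_det, ← Real.sqrt_prod _ fun j _ => by have := hμ j; positivity,
      Finset.prod_mul_distrib]
    simp
  have hden : 0 < ∏ j, Real.sqrt (2 * Real.pi * (1 + μ j)) :=
    Finset.prod_pos fun j _ => Real.sqrt_pos.2 (by have := hμ j; positivity)
  have h1 : rootConst S ^ 2 * |T.det|⁻¹ = (∏ j, Real.sqrt (2 * Real.pi * (1 + μ j)))⁻¹ := by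
    rw [rootConst, Real.sq_sqrt (by positivity), ← hdet, mul_inv, one_div]
  rw [← mul_assoc, h1, inv_mul_le_iff₀ hden, ← Finset.prod_mul_distrib]
  refine Finset.prod_le_prod (fun j _ => Real.sqrt_nonneg _) fun j _ => ?_
  have hlt := h.abs_lt_one hS j
  set r := Real.sqrt |μ j| with hr
  have hr2 : r ^ 2 = |μ j| := Real.sq_sqrt (abs_nonneg _)
  have hr0 : 0 ≤ r := Real.sqrt_nonneg _
  have hr1 : r < 1 := by nlinarith
  have hneg : -μ j ≤ r ^ 2 := hr2 ▸ neg_le_abs (μ j)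
  have hm : 0 < 1 - μ j := by have := (abs_lt.1 hlt).2; linarith
  have h1r : 0 < 1 - r := by linarith
  rw [Real.sqrt_le_iff]
  refine ⟨by positivity, ?_⟩
  rw [mul_pow, Real.sq_sqrt (by have := hμ j; positivity)]
  have e1 : 2 * Real.pi / ((1 - μ j ^ 2)⁻¹ * (1 - r)) =
      2 * Real.pi * (1 + μ j) * ((1 - μ j) / (1 - r)) := by
    have : 1 - μ j ^ 2 = (1 + μ j) * (1 - μ j) := by ring
    rw [this]
    have := hμ j
    field_simp
  rw [e1]
  refine mul_le_mul_of_nonneg_left ?_ (by have := hμ j; positivity)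
  rw [div_le_iff₀ h1r, inv_pow, inv_mul_eq_div, le_div_iff₀ (by positivity)]
  have : (1 - μ j) * (1 - r) ≤ 1 := by
    calc (1 - μ j) * (1 - r) ≤ (1 + r ^ 2) * (1 - r) := by
          apply mul_le_mul_of_nonneg_right _ h1r.le; linarith
      _ ≤ 1 := by nlinarith [sq_nonneg (r - 1), mul_nonneg hr0 (sq_nonneg r)]
  nlinarith

open Classical in
/-- The restriction of the vector `x` to `A`, extended by `0`. -/
noncomputable def restrictVec (A : Set (Fin D)) (x : Fin D → ℝ) : Fin D → ℝ :=
  fun i => if i ∈ A then x i else 0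

theorem restrictVec_congr {A : Set (Fin D)} {x x' : Fin D → ℝ} (h : ∀ i ∈ A, x i = x' i) :
    restrictVec A x = restrictVec A x' := by
  ext i
  by_cases hi : i ∈ A <;> simp [restrictVec, hi, h]

theorem continuous_restrictVec (A : Set (Fin D)) : Continuous (restrictVec A) := by
  refine continuous_pi fun i => ?_
  by_cases hi : i ∈ A
  · simpa [restrictVec, hi] using continuous_apply i
  · simpa [restrictVec, hi] using continuous_const

theorem restrictVec_add (A : Set (Fin D)) (x : Fin D → ℝ) :
    restrictVec A x + restrictVec Aᶜ x = x := by
  ext i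
  by_cases hi : i ∈ A <;> simp [restrictVec, hi]

theorem signMatrix_mulVec (A : Set (Fin D)) (x : Fin D → ℝ) :
    signMatrix A *ᵥ x = restrictVec A x - restrictVec Aᶜ x := by
  ext i
  rw [signMatrix, mulVec_diagonal]
  by_cases hi : i ∈ A <;> simp [restrictVec, hi]

/-- A combination that is even in the correlations has no terms that mix the two groups. -/
theorem IsCanonical.sum_even (h : IsCanonical S A T μ) (φ : ℝ → ℝ) (hφ : ∀ t, φ (-t) = φ t)
    (x : Fin D → ℝ) : ∑ j, φ (μ j) * (Tᵀ *ᵥ x) j ^ 2 =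
      ∑ j, φ (μ j) * ((Tᵀ *ᵥ restrictVec A x) j ^ 2 + (Tᵀ *ᵥ restrictVec Aᶜ x) j ^ 2) := by
  have h1 := h.sum_sign φ x
  simp only [hφ] at h1
  have h2 : ∑ j, φ (μ j) * (Tᵀ *ᵥ x) j ^ 2 + ∑ j, φ (μ j) * (Tᵀ *ᵥ (signMatrix A *ᵥ x)) j ^ 2 =
      2 * ∑ j, φ (μ j) *
        ((Tᵀ *ᵥ restrictVec A x) j ^ 2 + (Tᵀ *ᵥ restrictVec Aᶜ x) j ^ 2) := by
    rw [← Finset.sum_add_distrib, Finset.mul_sum]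
    refine Finset.sum_congr rfl fun j _ => ?_
    rw [signMatrix_mulVec, mulVec_sub, Pi.sub_apply]
    conv_lhs => rw [← restrictVec_add A x, mulVec_add, Pi.add_apply, restrictVec_add]
    ring
  linarith

/-- A combination that is odd in the correlations has only terms that mix the two groups. -/
theorem IsCanonical.sum_odd (h : IsCanonical S A T μ) (φ : ℝ → ℝ) (hφ : ∀ t, φ (-t) = -φ t)
    (x : Fin D → ℝ) : ∑ j, φ (μ j) * (Tᵀ *ᵥ x) j ^ 2 =
      2 * ∑ j, φ (μ j) * ((Tᵀ *ᵥ restrictVec A x) j * (Tᵀ *ᵥ restrictVec Aᶜ x) j) := by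
  have h1 := h.sum_sign φ x
  simp only [hφ, neg_mul, Finset.sum_neg_distrib] at h1
  have h2 : ∑ j, φ (μ j) * (Tᵀ *ᵥ x) j ^ 2 - ∑ j, φ (μ j) * (Tᵀ *ᵥ (signMatrix A *ᵥ x)) j ^ 2 =
      4 * ∑ j, φ (μ j) * ((Tᵀ *ᵥ restrictVec A x) j * (Tᵀ *ᵥ restrictVec Aᶜ x) j) := by
    rw [← Finset.sum_sub_distrib, Finset.mul_sum]
    refine Finset.sum_congr rfl fun j _ => ?_
    rw [signMatrix_mulVec, mulVec_sub, Pi.sub_apply]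
    conv_lhs => rw [← restrictVec_add A x, mulVec_add, Pi.add_apply, restrictVec_add]
    ring
  linarith

/-- If the canonical correlations across a bipartition are at most `s ^ 2, s ^ 4, s ^ 6, …`, then
the square root of the density is approximated to precision `K ^ 2 * δ` by a function of rank
`K ^ 2 / δ`: the coupling between the two groups is `exp (∑ b j * Y j * Y' j)` in canonical
coordinates, and its power series is truncated. -/
theorem exists_gaussian_approx (hS : S.PosDef) (A : Set (Fin D)) {s : ℝ} (hs : 0 < s) (hs1 : s < 1)
    (hcorr : ∀ j, canonicalCorr S A j ≤ (s ^ (j + 1)) ^ 2) {δ : ℝ} (hδ : 0 < δ) :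
    ∃ g : (Fin D → ℝ) → ℝ, HasRankLE ⌊correlationConst s ^ 2 / δ⌋₊ A g ∧
      Continuous (fun x => Real.sqrt (normalDensity S x) - g x) ∧
      (∃ C c : ℝ, 0 < c ∧ ∀ x, |Real.sqrt (normalDensity S x) - g x| ≤
        C * Real.exp (-c * ∑ i, x i ^ 2)) ∧
      eLpNorm (fun x => Real.sqrt (normalDensity S x) - g x) 2 volume ≤
        ENNReal.ofReal (correlationConst s ^ 2 * δ) := by
  obtain ⟨T, μ, h⟩ := exists_isCanonical hS A
  have hprod := h.prod_inv_le hS hs hs1 hcorr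
  have hK := one_le_correlationConst hs
  set K := correlationConst s
  have hμ := h.abs_lt_one hS
  set r : Fin D → ℝ := fun j => Real.sqrt |μ j| with hr
  have hr0 : ∀ j, 0 ≤ r j := fun j => Real.sqrt_nonneg _
  have hr2 : ∀ j, r j ^ 2 = |μ j| := fun j => Real.sq_sqrt (abs_nonneg _)
  have hr1 : ∀ j, r j < 1 := fun j => by nlinarith [hr2 j, hμ j, hr0 j]
  set β : Fin D → ℝ := fun j => (1 - μ j ^ 2)⁻¹ with hβ
  have hβ0 : ∀ j, 0 < β j := fun j => inv_pos.2 (by nlinarith [abs_lt.1 (hμ j)])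
  have hσ : ∀ j, ∃ σ : ℝ, r j * σ = μ j ∧ |σ| = r j := by
    intro j
    rcases le_total 0 (μ j) with h0 | h0
    · exact ⟨r j, by rw [← pow_two, hr2, abs_of_nonneg h0], abs_of_nonneg (hr0 j)⟩
    · exact ⟨-r j, by rw [mul_neg, ← pow_two, hr2, abs_of_nonpos h0, neg_neg],
        by rw [abs_neg, abs_of_nonneg (hr0 j)]⟩
  choose σ hσ1 hσ2 using hσ
  obtain ⟨t, htcard, ht⟩ := exists_truncation hr0 hr1 hδ
  set c₀ := rootConst S with hc₀
  have hc₀0 : 0 ≤ c₀ := Real.sqrt_nonneg _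
  set Y : Fin D → (Fin D → ℝ) → ℝ := fun j x => (Tᵀ *ᵥ restrictVec A x) j with hY
  set Y' : Fin D → (Fin D → ℝ) → ℝ := fun j x => (Tᵀ *ᵥ restrictVec Aᶜ x) j with hY'
  have hYc : ∀ j, Continuous (Y j) := fun j =>
    (continuous_apply j).comp ((continuous_const).matrix_mulVec (continuous_restrictVec A))
  have hYc' : ∀ j, Continuous (Y' j) := fun j =>
    (continuous_apply j).comp ((continuous_const).matrix_mulVec (continuous_restrictVec Aᶜ))
  have hYd : ∀ x x' : Fin D → ℝ, (∀ i ∈ A, x i = x' i) → ∀ j, Y j x = Y j x' :=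
    fun x x' hx j => by simp only [hY, restrictVec_congr hx]
  have hYd' : ∀ x x' : Fin D → ℝ, (∀ i ∈ Aᶜ, x i = x' i) → ∀ j, Y' j x = Y' j x' :=
    fun x x' hx j => by simp only [hY', restrictVec_congr hx]
  set z : (Fin D → ℝ) → Fin D → ℝ := fun x j => 1 / 2 * β j * σ j * (Y j x * Y' j x) with hz
  have hrz : ∀ x j, r j * z x j = (1 / 2 * β j * μ j * Y j x) * Y' j x := by
    intro x j
    rw [← hσ1 j, hz]; ring
  set u : (Fin D → ℕ) → (Fin D → ℝ) → ℝ := fun n x =>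
    c₀ * Real.exp (-(1 / 4) * ∑ j, β j * Y j x ^ 2) *
      ∏ j, (1 / 2 * β j * μ j * Y j x) ^ n j / (n j).factorial with hu
  set v : (Fin D → ℕ) → (Fin D → ℝ) → ℝ := fun n x =>
    Real.exp (-(1 / 4) * ∑ j, β j * Y' j x ^ 2) * ∏ j, Y' j x ^ n j with hv
  set E : (Fin D → ℝ) → ℝ := fun x =>
    c₀ * Real.exp (-(1 / 4) * ∑ j, β j * (Y j x ^ 2 + Y' j x ^ 2)) with hE
  have hE0 : ∀ x, 0 ≤ E x := fun x => mul_nonneg hc₀0 (Real.exp_pos _).le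
  have huv : ∀ x, ∑ n ∈ t, u n x * v n x =
      E x * ∑ n ∈ t, ∏ j, (r j * z x j) ^ n j / (n j).factorial := by
    intro x
    rw [Finset.mul_sum]
    refine Finset.sum_congr rfl fun n _ => ?_
    have e1 : ∏ j, (r j * z x j) ^ n j / ((n j).factorial : ℝ) =
        (∏ j, (1 / 2 * β j * μ j * Y j x) ^ n j / ((n j).factorial : ℝ)) * ∏ j, Y' j x ^ n j := by
      rw [← Finset.prod_mul_distrib]
      refine Finset.prod_congr rfl fun j _ => ?_
      rw [hrz, mul_pow]; ring
    have e2 : E x = c₀ * Real.exp (-(1 / 4) * ∑ j, β j * Y j x ^ 2) *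
        Real.exp (-(1 / 4) * ∑ j, β j * Y' j x ^ 2) := by
      rw [hE, mul_assoc, ← Real.exp_add]
      simp only [mul_add, Finset.sum_add_distrib]
    rw [e1, e2]
    simp only [hu, hv]; ring
  have hψ : ∀ x, Real.sqrt (normalDensity S x) = E x * Real.exp (∑ j, r j * z x j) := by
    intro x
    rw [h.sqrt_normalDensity hS, hE, mul_assoc, ← Real.exp_add]
    congr 2
    have e1 := h.sum_even (fun t => (1 - t ^ 2)⁻¹) (fun t => by simp) x
    have e2 := h.sum_odd (fun t => (1 - t ^ 2)⁻¹ * t) (fun t => by simp) x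
    have e3 : ∑ j, (1 + μ j)⁻¹ * (Tᵀ *ᵥ x) j ^ 2 = ∑ j, β j * (Tᵀ *ᵥ x) j ^ 2 -
        ∑ j, β j * μ j * (Tᵀ *ᵥ x) j ^ 2 := by
      rw [← Finset.sum_sub_distrib]
      refine Finset.sum_congr rfl fun j _ => ?_
      have h1 : (1 + μ j) ≠ 0 := by linarith [(abs_lt.1 (hμ j)).1]
      have h2 : (1 - μ j) ≠ 0 := by linarith [(abs_lt.1 (hμ j)).2]
      have h3 : β j = ((1 + μ j) * (1 - μ j))⁻¹ := by rw [hβ]; ring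
      rw [h3]; field_simp
    have e4 : ∑ j, r j * z x j = 1 / 2 * ∑ j, β j * μ j * (Y j x * Y' j x) := by
      rw [Finset.mul_sum]
      exact Finset.sum_congr rfl fun j _ => by rw [hrz]; ring
    rw [e3, e4]
    simp only [hβ, hY, hY']
    rw [e1, e2]; ring
  -- The rate of decay of the error in canonical coordinates.
  set d : Fin D → ℝ := fun j => (1 - μ j ^ 2)⁻¹ * (1 - Real.sqrt |μ j|) with hd
  have hd0 : ∀ j, 0 < d j := fun j => mul_pos (hβ0 j) (by linarith [hr1 j])
  have herr : ∀ x, |Real.sqrt (normalDensity S x) - ∑ n ∈ t, u n x * v n x| ≤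
      δ * c₀ * Real.exp (-(1 / 4) * ∑ j, d j * (Tᵀ *ᵥ x) j ^ 2) := by
    intro x
    rw [hψ, huv, ← mul_sub, abs_mul, abs_of_nonneg (hE0 x)]
    refine (mul_le_mul_of_nonneg_left (ht (z x)) (hE0 x)).trans ?_
    have e1 : ∑ j, |z x j| ≤
        ∑ j, 1 / 4 * (β j * r j * (Y j x ^ 2 + Y' j x ^ 2)) := by
      refine Finset.sum_le_sum fun j _ => ?_
      simp only [hz]
      rw [abs_mul, abs_mul, hσ2, abs_of_nonneg (by have := hβ0 j; positivity)]
      have h1 : |Y j x * Y' j x| ≤ (Y j x ^ 2 + Y' j x ^ 2) / 2 := by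
        rw [abs_le]
        constructor <;> nlinarith [sq_nonneg (Y j x - Y' j x), sq_nonneg (Y j x + Y' j x)]
      have h2 := mul_le_mul_of_nonneg_left h1 (mul_nonneg (hβ0 j).le (hr0 j))
      linarith
    have e2 := h.sum_even (fun t => (1 - t ^ 2)⁻¹ * (1 - Real.sqrt |t|)) (fun t => by simp) x
    calc E x * (δ * Real.exp (∑ j, |z x j|))
        ≤ E x * (δ * Real.exp (∑ j, 1 / 4 * (β j * r j * (Y j x ^ 2 + Y' j x ^ 2)))) := by
          gcongr
      _ = δ * c₀ * Real.exp (-(1 / 4) * ∑ j, β j * (Y j x ^ 2 + Y' j x ^ 2) +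
            ∑ j, 1 / 4 * (β j * r j * (Y j x ^ 2 + Y' j x ^ 2))) := by
          rw [Real.exp_add, hE]; ring
      _ = _ := by
          simp only [hd]
          rw [e2, Finset.mul_sum, Finset.mul_sum, ← Finset.sum_add_distrib]
          congr 2
          exact Finset.sum_congr rfl fun j _ => by simp only [hβ, hr, hY, hY']; ring
  obtain ⟨c, hc, hcd⟩ := h.exists_le_sum hd0
  have hdecay : ∀ k : ℝ, 0 < k → ∀ x : Fin D → ℝ,
      Real.exp (-k * ∑ j, d j * (Tᵀ *ᵥ x) j ^ 2) ≤ Real.exp (-(k * c) * ∑ i, x i ^ 2) := by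
    intro k hk x
    refine Real.exp_le_exp.2 ?_
    have := mul_le_mul_of_nonneg_left (hcd x) hk.le
    linarith
  refine ⟨fun x => ∑ n ∈ t, u n x * v n x, ?_, ?_, ?_, ?_⟩
  · refine hasRankLE_of_finset_sum t (Nat.le_floor (htcard.trans ?_)) u v ?_ ?_ fun x => rfl
    · gcongr
    · intro n x x' hx
      simp only [hu, hYd x x' hx]
    · intro n x x' hx
      simp only [hv, hYd' x x' hx]
  · refine (continuous_sqrt_normalDensity S).sub (continuous_finsetSum _ fun n _ => ?_)
    simp only [hu, hv]
    fun_prop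
  · refine ⟨δ * c₀, 1 / 4 * c, by positivity, fun x => (herr x).trans ?_⟩
    exact mul_le_mul_of_nonneg_left (hdecay (1 / 4) (by norm_num) x) (by positivity)
  · set Bd : (Fin D → ℝ) → ℝ := fun x =>
      δ * c₀ * Real.exp (-(1 / 4) * ∑ j, d j * (Tᵀ *ᵥ x) j ^ 2) with hBd
    have hcont : Continuous fun x : Fin D → ℝ => ∑ j, d j * (Tᵀ *ᵥ x) j ^ 2 := by
      refine continuous_finsetSum _ fun j _ => continuous_const.mul (Continuous.pow ?_ 2)
      exact (continuous_apply j).comp (continuous_const.matrix_mulVec continuous_id)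
    have hBd2 : (fun x => Bd x ^ 2) = fun x =>
        (δ * c₀) ^ 2 * Real.exp (-(1 / 2) * ∑ j, d j * (Tᵀ *ᵥ x) j ^ 2) := by
      ext x
      rw [hBd, mul_pow, ← Real.exp_nat_mul]
      congr 2; push_cast; ring
    have hint : Integrable fun x : Fin D → ℝ =>
        Real.exp (-(1 / 2) * ∑ j, d j * (Tᵀ *ᵥ x) j ^ 2) := by
      refine (integrable_exp_neg_mul_sum_sq (I := Fin D) (c := 1 / 2 * c) (by positivity)).mono'
        (Real.continuous_exp.comp (continuous_const.mul hcont)).aestronglyMeasurable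
        (Filter.Eventually.of_forall fun x => ?_)
      rw [Real.norm_eq_abs, abs_of_pos (Real.exp_pos _)]
      exact hdecay (1 / 2) (by norm_num) x
    have hmem : MemLp Bd 2 volume := by
      rw [memLp_two_iff_integrable_sq]
      · rw [hBd2]; exact hint.const_mul _
      · exact (continuous_const.mul
          (Real.continuous_exp.comp (continuous_const.mul hcont))).aestronglyMeasurable
    refine (eLpNorm_mono_real (g := Bd) fun x => herr x).trans ?_
    rw [eLpNorm_two_eq_sqrt hmem, hBd2, integral_const_mul,
      integral_exp_neg_quadratic h.det_ne_zero]
    refine ENNReal.ofReal_le_ofReal (Real.sqrt_le_iff.2 ⟨by positivity, ?_⟩)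
    have h1 := (h.rootConst_sq_mul_le hS).trans hprod
    have h2 : K ^ 2 ≤ (K ^ 2) ^ 2 := le_self_pow₀ (one_le_pow₀ hK) two_ne_zero
    calc _ = δ ^ 2 * (c₀ ^ 2 * (|T.det|⁻¹ * ∏ j, Real.sqrt (2 * Real.pi / d j))) := by ring
      _ ≤ δ ^ 2 * (K ^ 2) ^ 2 := by
        refine mul_le_mul_of_nonneg_left (h1.trans h2) (by positivity)
      _ = _ := by ring

end Gaussian

/-! ### Step functions as functional tree tensor networks -/

section Network

variable {V : Type*} [Fintype V] {G : SimpleGraph V}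

/-- Assignments of the indices of all vertices in which the index of the root is `0` correspond to
assignments of the indices of all edges. -/
theorem sum_root_pinned [DecidableEq V] {E : Type*} [Fintype E] {χ : ℕ} [NeZero χ] {r : V}
    [Fintype (E → Fin χ)] (e : {v // v ≠ r} ≃ E) (F : (V → Fin χ) → ℝ) :
    ∑ a : V → Fin χ, (if a r = 0 then 1 else 0) * F a =
      ∑ a : E → Fin χ, F ((Equiv.funSplitAt r (Fin χ)).symm (0, fun v => a (e v))) := by
  rw [← (Equiv.funSplitAt r (Fin χ)).symm.sum_comp, Fintype.sum_prod_type]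
  have h0 : ∀ (j : Fin χ) (b : {v // v ≠ r} → Fin χ),
      (Equiv.funSplitAt r (Fin χ)).symm (j, b) r = j := by
    intro j b; simp [Equiv.funSplitAt]
  simp only [h0, ite_mul, one_mul, zero_mul]
  rw [Finset.sum_comm]
  simp only [Finset.sum_ite_eq', Finset.mem_univ, if_true]
  exact Fintype.sum_equiv (e.arrowCongr (Equiv.refl _)) _ _ fun b => by
    have hb : (fun v => (e.arrowCongr (Equiv.refl (Fin χ))) b (e v)) = b := by
      funext v
      change b (e.symm (e v)) = b v
      rw [e.symm_apply_apply]
    rw [hb]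

/-- A step function of low rank across every edge of a tree is represented by a functional tree
tensor network. -/
theorem exists_functionalTN {r : V} {par : V → V} (h : IsParent G r par) {D : ℕ}
    (site : Fin D → V) {N : ℕ} (hN : 0 < N) {χ : ℕ} [NeZero χ] (f : (Fin D → GridIdx N) → ℝ)
    (hf : ∀ v, v ≠ r → HasRankLE χ (belowSet par site v) f) :
    ∃ T : FunctionalTN G site, (∀ e, T.bondDim e = χ) ∧ ∀ x, T.toFun x = stepFn N f x := by
  classical
  have := nonempty_gridIdx hN
  obtain ⟨γ, hγa, hγx, hsum⟩ := exists_network h.root h.dist_lt site f hf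
  let dflt : GridIdx N := Classical.arbitrary _
  let extA : (v : V) → ((e : {e : G.edgeSet // v ∈ (e : Sym2 V)}) → Fin χ) → V → Fin χ :=
    fun v b u => if hu : ∃ hu : u ≠ r, v ∈ ((h.edgeEquiv ⟨u, hu⟩ : G.edgeSet) : Sym2 V) then
      b ⟨h.edgeEquiv ⟨u, hu.1⟩, hu.2⟩ else 0
  let extX : (v : V) → ({i : Fin D // site i = v} → GridIdx N) → Fin D → GridIdx N :=
    fun v m i => if hi : site i = v then m ⟨i, hi⟩ else dflt
  refine ⟨⟨fun _ => χ, fun _ => Nat.pos_of_neZero χ,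
    fun v b => stepFn N fun m => γ v (extA v b) (extX v m),
    fun v b => memLp_stepFn hN _ 2⟩, fun _ => rfl, fun x => ?_⟩
  unfold FunctionalTN.toFun
  simp only
  by_cases hx : ∃ m, x ∈ gridCell N m
  · obtain ⟨m, hm⟩ := hx
    rw [stepFn_of_mem hm, hsum, sum_root_pinned h.edgeEquiv fun a => ∏ v, γ v a m]
    refine Finset.sum_congr (by congr!) fun a _ => Finset.prod_congr rfl fun v _ => ?_
    rw [stepFn_of_mem (m := fun i : {i : Fin D // site i = v} => m i.1) (fun i => hm i.1)]
    have h1 := hγx v (extA v fun e => a e.1)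
      (x := extX v fun i => m i.1) (y := m) (fun i hi => by
        have hi' : site i = v := hi
        simp only [extX, hi', dif_pos])
    rw [h1]
    refine hγa v m fun u hu => ?_
    obtain ⟨hne, hor⟩ : u ≠ r ∧ (u = v ∨ par u = v) := hu
    have hmem : v ∈ ((h.edgeEquiv ⟨u, hne⟩ : G.edgeSet) : Sym2 V) := by
      rw [h.coe_edgeEquiv]
      rcases hor with h2 | h2
      · exact h2 ▸ Sym2.mem_mk_left _ _
      · exact h2 ▸ Sym2.mem_mk_right _ _
    simp only [extA]
    rw [dif_pos ⟨hne, hmem⟩]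
    simp [Equiv.funSplitAt, hne]
  · rw [stepFn_of_notMem fun m hm => hx ⟨m, hm⟩]
    have hout : ∃ i, ⌊(N : ℝ) * x i⌋ ∉ Finset.Ico (-(N : ℤ) ^ 2) ((N : ℤ) ^ 2) := by
      by_contra hcon
      push Not at hcon
      exact hx ⟨fun i => ⟨_, hcon i⟩, fun i => rfl⟩
    obtain ⟨i, hi⟩ := hout
    refine Finset.sum_eq_zero fun a _ => Finset.prod_eq_zero (Finset.mem_univ (site i)) ?_
    refine stepFn_of_notMem fun m hm => hi ?_
    have := hm ⟨i, rfl⟩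
    simp only at this
    rw [this]
    exact (m ⟨i, rfl⟩).2

end Network

/-! ### Assembling the approximation -/

section Assembly

theorem HasRankLE.comp_gridPt {I : Type*} {χ N : ℕ} {A : Set I} {g : (I → ℝ) → ℝ}
    (hg : HasRankLE χ A g) : HasRankLE χ A fun m : I → GridIdx N => g (gridPt N m) := by
  obtain ⟨u, v, hu, hv, huv⟩ := hg
  have hpt : ∀ (B : Set I) (m m' : I → GridIdx N), (∀ i ∈ B, m i = m' i) →
      ∀ i ∈ B, gridPt N m i = gridPt N m' i := fun B m m' h i hi => by
    simp only [gridPt, h i hi]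
  exact ⟨fun j m => u j (gridPt N m), fun j m => v j (gridPt N m),
    fun j m m' h => hu j (hpt _ _ _ h), fun j m m' h => hv j (hpt _ _ _ h), fun m => huv _⟩

/-- In a laminar family, a nonempty set is determined by its cardinality and any of its elements. -/
theorem card_laminar_le {D : ℕ} (𝒜 : Finset (Set (Fin D)))
    (hlam : ∀ A ∈ 𝒜, ∀ B ∈ 𝒜, A ⊆ B ∨ B ⊆ A ∨ Disjoint A B) : 𝒜.card ≤ (D + 1) ^ 2 := by
  classical
  let φ : Set (Fin D) → Option (Fin D) × Fin (D + 1) := fun A =>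
    (if hA : A.Nonempty then some hA.some else none,
      ⟨A.ncard, by have := Set.ncard_le_card A; simp at this; omega⟩)
  have hinj : Set.InjOn φ 𝒜 := by
    intro A hA B hB hAB
    have h1 := congrArg Prod.fst hAB
    have h2 : A.ncard = B.ncard := congrArg Fin.val (congrArg Prod.snd hAB)
    simp only [φ] at h1
    by_cases hA' : A.Nonempty
    · by_cases hB' : B.Nonempty
      · rw [dif_pos hA', dif_pos hB'] at h1
        rcases hlam A hA B hB with h | h | h
        · exact Set.eq_of_subset_of_ncard_le h h2.ge B.toFinite
        · exact (Set.eq_of_subset_of_ncard_le h h2.le A.toFinite).symm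
        · refine (Set.disjoint_left.1 h hA'.some_mem ?_).elim
          rw [Option.some.inj h1]; exact hB'.some_mem
      · rw [dif_pos hA', dif_neg hB'] at h1; cases h1
    · by_cases hB' : B.Nonempty
      · rw [dif_neg hA', dif_pos hB'] at h1; cases h1
      · rw [Set.not_nonempty_iff_eq_empty.1 hA', Set.not_nonempty_iff_eq_empty.1 hB']
  calc 𝒜.card = (𝒜.image φ).card := (Finset.card_image_of_injOn hinj).symm
    _ ≤ Fintype.card (Option (Fin D) × Fin (D + 1)) := Finset.card_le_univ _
    _ = (D + 1) ^ 2 := by simp [pow_two]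

/-- Correlations below both a constant less than `1` and an exponentially decaying sequence are
below a geometric sequence starting at its ratio. -/
theorem exists_rate {α θ ρ₀ : ℝ} (hα : 0 < α) (hθ : 0 < θ) (hρ₀ : ρ₀ < 1) :
    ∃ s : ℝ, 0 < s ∧ s < 1 ∧ ∀ (j : ℕ) (t : ℝ), t ≤ ρ₀ → t ≤ α * Real.exp (-θ * ((j : ℝ) + 1)) →
      t ≤ (s ^ (j + 1)) ^ 2 := by
  set ρ : ℝ := max ρ₀ (1 / 2) with hρ
  have hρ0 : 0 < ρ := lt_of_lt_of_le (by norm_num) (le_max_right _ _)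
  have hρ1 : ρ < 1 := max_lt hρ₀ (by norm_num)
  set l : ℝ := -Real.log ρ with hl
  have hl0 : 0 < l := neg_pos.2 (Real.log_neg hρ0 hρ1)
  set a : ℝ := max (Real.log α) 0
  have ha : 0 ≤ a := le_max_right _ _
  -- The rate solves `l = c * k` at the `k` where `l = θ * k - a`.
  set c : ℝ := l * θ / (a + l) with hc
  have hc0 : 0 < c := by positivity
  refine ⟨Real.exp (-(c / 2)), Real.exp_pos _, (Real.exp_lt_exp.2 (by linarith)).trans_eq Real.exp_zero,
    fun j t h1 h2 => ?_⟩
  have h3 : (Real.exp (-(c / 2)) ^ (j + 1)) ^ 2 = Real.exp (-(c * (j + 1))) := by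
    rw [← pow_mul, ← Real.exp_nat_mul]
    congr 1; push_cast; ring
  rw [h3]
  have h4 : t ≤ Real.exp (-l) := by
    rw [hl, neg_neg, Real.exp_log hρ0]; exact h1.trans (le_max_left _ _)
  have h5 : t ≤ Real.exp (a - θ * (j + 1)) := by
    refine h2.trans ?_
    have : α ≤ Real.exp a := by
      rw [← Real.log_le_iff_le_exp hα]; exact le_max_left _ _
    calc α * Real.exp (-θ * (j + 1)) ≤ Real.exp a * Real.exp (-θ * (j + 1)) := by gcongr
      _ = _ := by rw [← Real.exp_add]; ring_nf
  have hcomb : c * (j + 1) * (a + l) = a * l + l * (θ * (j + 1) - a) := by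
    rw [hc]; field_simp; ring
  rcases le_total (c * (j + 1)) l with h | h
  · exact h4.trans (Real.exp_le_exp.2 (by linarith))
  · refine h5.trans (Real.exp_le_exp.2 ?_)
    have : l * (c * (j + 1)) ≤ l * (θ * (j + 1) - a) := by nlinarith
    have := le_of_mul_le_mul_left this hl0
    linarith

variable {V : Type*} [Fintype V] {G : SimpleGraph V}

/-- The approximation with explicit constants: precision `ε` is reached with bond dimension
`8 * D ^ 2 * K ^ 4 / ε`. -/
theorem exists_functionalTN_normalDensity (hG : G.IsTree) {D : ℕ} (hD : 0 < D)
    (site : Fin D → V) {S : Matrix (Fin D) (Fin D) ℝ} (hS : S.PosDef) {s : ℝ} (hs : 0 < s)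
    (hs1 : s < 1) (hcorr : ∀ u v, G.Adj u v → ∀ j,
      canonicalCorr S (edgeSide G site u v) j ≤ (s ^ (j + 1)) ^ 2)
    {ε : ℝ} (hε : 0 < ε) (hε1 : ε ≤ 1) :
    ∃ T : FunctionalTN G site,
      eLpNorm (fun x => Real.sqrt (normalDensity S x) - T.toFun x) 2 volume ≤ ENNReal.ofReal ε ∧
      (T.maxBondDim : ℝ) ≤ 8 * (D : ℝ) ^ 2 * correlationConst s ^ 4 / ε := by
  classical
  obtain ⟨r⟩ := hG.connected.nonempty
  obtain ⟨par, hpar⟩ := hG.exists_isParent r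
  have hK := one_le_correlationConst hs
  set K := correlationConst s
  have hD1 : (1 : ℝ) ≤ D := by exact_mod_cast hD
  set δ : ℝ := ε / (8 * (D : ℝ) ^ 2 * K ^ 2) with hδ
  have hδ0 : 0 < δ := by positivity
  have hratio : K ^ 2 / δ = 8 * (D : ℝ) ^ 2 * K ^ 4 / ε := by
    rw [hδ]; field_simp
  set χ := ⌊K ^ 2 / δ⌋₊ with hχ
  have hχ1 : 1 ≤ χ := by
    rw [hχ, Nat.one_le_floor_iff, hratio, le_div_iff₀ hε]
    have h1 : 1 ≤ (D : ℝ) ^ 2 := one_le_pow₀ hD1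
    have h2 : 1 ≤ K ^ 4 := one_le_pow₀ hK
    nlinarith
  have : NeZero χ := ⟨by omega⟩
  set 𝒜 : Finset (Set (Fin D)) := (Finset.univ.erase r).image (belowSet par site) with h𝒜
  have hlam : ∀ A ∈ 𝒜, ∀ B ∈ 𝒜, A ⊆ B ∨ B ⊆ A ∨ Disjoint A B := by
    intro A hA B hB
    obtain ⟨u, -, rfl⟩ := Finset.mem_image.1 hA
    obtain ⟨v, -, rfl⟩ := Finset.mem_image.1 hB
    exact belowSet_laminar site u v
  have hcard : (𝒜.card : ℝ) ≤ 4 * (D : ℝ) ^ 2 := by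
    have h1 : (𝒜.card : ℝ) ≤ ((D : ℝ) + 1) ^ 2 := by exact_mod_cast card_laminar_le 𝒜 hlam
    nlinarith
  set ψ : (Fin D → ℝ) → ℝ := fun x => Real.sqrt (normalDensity S x) with hψ
  have happ : ∀ A : Set (Fin D), ∃ g : (Fin D → ℝ) → ℝ, A ∈ 𝒜 → HasRankLE χ A g ∧
      Continuous (fun x => ψ x - g x) ∧
      (∃ C c : ℝ, 0 < c ∧ ∀ x, |ψ x - g x| ≤ C * Real.exp (-c * ∑ i, x i ^ 2)) ∧
      eLpNorm (fun x => ψ x - g x) 2 volume ≤ ENNReal.ofReal (K ^ 2 * δ) := by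
    intro A
    by_cases hA : A ∈ 𝒜
    · obtain ⟨v, hv, hvA⟩ := Finset.mem_image.1 hA
      have hvr := Finset.ne_of_mem_erase hv
      have hside := hpar.edgeSide_eq site hvr
      obtain ⟨g, hg⟩ := exists_gaussian_approx hS A hs hs1 (fun j => by
        rw [← hvA, ← hside]; exact hcorr v (par v) (hpar.adj v hvr) j) hδ0
      exact ⟨g, fun _ => hg⟩
    · exact ⟨0, fun h => absurd h hA⟩
  choose g hg using happ
  set ω : ℝ := ε / (10 * (D : ℝ) ^ 2) with hω
  have hω0 : 0 < ω := by positivity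
  have hωe : 0 < ENNReal.ofReal ω := ENNReal.ofReal_pos.2 hω0
  -- A grid that is fine enough for `ψ` and for all error terms at once.
  obtain ⟨Cψ, cψ, hcψ, hψle⟩ := exists_sqrt_normalDensity_le hS
  have hev1 := (tendsto_eLpNorm_sub_stepFn (continuous_sqrt_normalDensity S) hcψ
    hψle).eventually_le_const hωe
  have hev2 : ∀ᶠ N : ℕ in Filter.atTop, ∀ A ∈ 𝒜, eLpNorm (fun x => (ψ x - g A x) -
      stepFn N (fun m => ψ (gridPt N m) - g A (gridPt N m)) x) 2 volume ≤ ENNReal.ofReal ω := by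
    rw [Filter.eventually_all_finset]
    intro A hA
    obtain ⟨-, hcont, ⟨C, c, hc, hle⟩, -⟩ := hg A hA
    exact (tendsto_eLpNorm_sub_stepFn hcont hc hle).eventually_le_const hωe
  obtain ⟨N, hN1, hN2, hN⟩ := (hev1.and (hev2.and (Filter.eventually_gt_atTop 0))).exists
  set f : (Fin D → GridIdx N) → ℝ := fun m => ψ (gridPt N m) with hf
  set η : ℝ := K ^ 2 * δ + ω with hη
  have hη0 : 0 ≤ η := by positivity
  set h : ℝ := Real.sqrt ((1 / N : ℝ) ^ Fintype.card (Fin D)) with hh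
  have hh0 : 0 < h := Real.sqrt_pos.2 (by
    have : (0 : ℝ) < N := by exact_mod_cast hN
    positivity)
  have hgrid : ∀ A ∈ 𝒜, ∃ f', HasRankLE χ A f' ∧ ‖WithLp.toLp 2 (f - f')‖ ≤ η / h := by
    intro A hA
    obtain ⟨hrank, hcont, -, hnorm⟩ := hg A hA
    refine ⟨fun m => g A (gridPt N m), hrank.comp_gridPt, ?_⟩
    set F : (Fin D → GridIdx N) → ℝ := fun m => ψ (gridPt N m) - g A (gridPt N m) with hF
    have h1 : eLpNorm (stepFn N F) 2 volume ≤ ENNReal.ofReal η := by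
      have h2 : stepFn N F = (fun x => ψ x - g A x) - fun x => (ψ x - g A x) - stepFn N F x := by
        ext x; simp
      rw [h2, hη, ENNReal.ofReal_add (by positivity) hω0.le]
      refine (eLpNorm_sub_le hcont.aestronglyMeasurable (hcont.aestronglyMeasurable.sub
        (memLp_stepFn hN F 2).aestronglyMeasurable) (by norm_num)).trans ?_
      exact add_le_add hnorm (hN2 A hA)
    rw [eLpNorm_stepFn hN, ENNReal.ofReal_le_ofReal_iff hη0] at h1
    rw [le_div_iff₀ hh0, mul_comm]
    exact h1
  obtain ⟨f', hf'rank, hf'norm⟩ := exists_hasRankLE_laminar f 𝒜 hlam hgrid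
  obtain ⟨T, hTdim, hTfun⟩ := exists_functionalTN hpar site hN f' fun v hv =>
    hf'rank _ (Finset.mem_image_of_mem _ (Finset.mem_erase.2 ⟨hv, Finset.mem_univ _⟩))
  refine ⟨T, ?_, ?_⟩
  · have h1 : (fun x => ψ x - T.toFun x) =
        (fun x => ψ x - stepFn N f x) + stepFn N (f - f') := by
      ext x
      rw [hTfun, Pi.add_apply, stepFn_sub]; ring
    have h2 : eLpNorm (stepFn N (f - f')) 2 volume ≤ ENNReal.ofReal (𝒜.card * η) := by
      rw [eLpNorm_stepFn hN]
      refine ENNReal.ofReal_le_ofReal ?_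
      calc h * ‖WithLp.toLp 2 (f - f')‖ ≤ h * (𝒜.card * (η / h)) := by gcongr
        _ = _ := by field_simp
    change eLpNorm (fun x => ψ x - T.toFun x) 2 volume ≤ _
    rw [h1]
    refine (eLpNorm_add_le ((continuous_sqrt_normalDensity S).aestronglyMeasurable.sub
      (memLp_stepFn hN f 2).aestronglyMeasurable)
      (memLp_stepFn hN _ 2).aestronglyMeasurable (by norm_num)).trans ?_
    refine (add_le_add hN1 h2).trans ?_
    rw [← ENNReal.ofReal_add hω0.le (by positivity)]
    refine ENNReal.ofReal_le_ofReal ?_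
    have e1 : 4 * (D : ℝ) ^ 2 * (K ^ 2 * δ) = ε / 2 := by rw [hδ]; field_simp; norm_num
    have e2 : 5 * (D : ℝ) ^ 2 * ω = ε / 2 := by rw [hω]; field_simp; norm_num
    have e3 : (𝒜.card : ℝ) * η ≤ 4 * (D : ℝ) ^ 2 * η := by gcongr
    have e4 : ω ≤ (D : ℝ) ^ 2 * ω := le_mul_of_one_le_left hω0.le (one_le_pow₀ hD1)
    rw [hη] at e3 ⊢
    linarith
  · have h1 : T.maxBondDim ≤ χ := by
      unfold FunctionalTN.maxBondDim
      exact Finset.sup_le fun e _ => (hTdim e).le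
    rw [← hratio]
    calc (T.maxBondDim : ℝ) ≤ χ := by exact_mod_cast h1
      _ ≤ _ := Nat.floor_le (by positivity)

end Assembly

theorem theorem2 (α θ ρ₀ : ℝ) (hα : 0 < α) (hθ : 0 < θ) (hρ₀ : ρ₀ < 1) :
    ∃ C₁ C₂ C₃ : ℝ, 0 < C₁ ∧ 0 < C₂ ∧ 0 < C₃ ∧
      ∀ (D : ℕ), 0 < D →
      ∀ (V : Type*) [Fintype V] (G : SimpleGraph V), G.IsTree →
      ∀ (site : Fin D → V) (S : Matrix (Fin D) (Fin D) ℝ), S.PosDef →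
      (∀ u v : V, G.Adj u v → ∀ j : ℕ,
        canonicalCorr S (edgeSide G site u v) j ≤ ρ₀ ∧
        canonicalCorr S (edgeSide G site u v) j ≤ α * Real.exp (-θ * ((j : ℝ) + 1))) →
      ∀ ε : ℝ, 0 < ε → ε ≤ 1 →
        -- the logarithms in the bound have arguments greater than 1 (the outer one: positive)
        1 < C₂ * Real.sqrt D / ε ∧
        1 < 2 * C₁ * Real.log (C₂ * Real.sqrt D / ε) * Real.sqrt D / ε ∧
        ∃ T : FunctionalTN G site,
          eLpNorm (fun x => Real.sqrt (normalDensity S x) - T.toFun x) 2 volume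
            ≤ ENNReal.ofReal ε ∧
          (T.maxBondDim : ℝ) ≤
            (C₂ * Real.sqrt D / ε) ^
              (C₁ * Real.log (C₃ *
                Real.log (2 * C₁ * Real.log (C₂ * Real.sqrt D / ε) * Real.sqrt D / ε))) := by
  obtain ⟨s, hs, hs1, hrate⟩ := exists_rate hα hθ hρ₀
  have hK := one_le_correlationConst hs
  set K := correlationConst s with hKdef
  have he := Real.exp_pos 1
  have he' := Real.exp_one_lt_d9
  refine ⟨4, Real.exp 1 + 2 * K, Real.exp 1, by norm_num, by positivity, he, ?_⟩
  intro D hD V _ G hG site S hS hcorr ε hε hε1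
  have hD1 : (1 : ℝ) ≤ D := by exact_mod_cast hD
  have hsqrt : 1 ≤ Real.sqrt D := Real.one_le_sqrt.2 hD1
  have hquot : 1 ≤ Real.sqrt D / ε := by rw [le_div_iff₀ hε]; linarith
  set B : ℝ := (Real.exp 1 + 2 * K) * Real.sqrt D / ε with hB
  have hBe : Real.exp 1 ≤ B := by rw [hB, mul_div_assoc]; nlinarith
  have hB1 : 1 < B := lt_of_lt_of_le (Real.one_lt_exp_iff.2 one_pos) hBe
  have hlog1 : 1 ≤ Real.log B := by rwa [Real.le_log_iff_exp_le (by linarith)]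
  have harg : Real.exp 1 ≤ 2 * 4 * Real.log B * Real.sqrt D / ε := by
    rw [mul_div_assoc]; nlinarith
  have hlog2 : 1 ≤ Real.log (2 * 4 * Real.log B * Real.sqrt D / ε) := by
    rwa [Real.le_log_iff_exp_le (by linarith)]
  have hlog3 : 1 ≤ Real.log (Real.exp 1 *
      Real.log (2 * 4 * Real.log B * Real.sqrt D / ε)) := by
    rw [Real.le_log_iff_exp_le (by positivity)]
    exact le_mul_of_one_le_right he.le hlog2
  refine ⟨hB1, lt_of_lt_of_le (Real.one_lt_exp_iff.2 one_pos) harg, ?_⟩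
  obtain ⟨T, hT1, hT2⟩ := exists_functionalTN_normalDensity hG hD site hS hs hs1
    (fun u v huv j => hrate j _ (hcorr u v huv j).1 (hcorr u v huv j).2) hε hε1
  refine ⟨T, hT1, hT2.trans ?_⟩
  -- The exponent is at least `4`, and `B ^ 4` already suffices.
  have hpow : B ^ (4 : ℕ) ≤ B ^ (4 * Real.log (Real.exp 1 *
      Real.log (2 * 4 * Real.log B * Real.sqrt D / ε))) := by
    rw [← Real.rpow_natCast]
    refine Real.rpow_le_rpow_of_exponent_le hB1.le ?_
    push_cast; linarith
  refine le_trans ?_ hpow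
  have hD2 : Real.sqrt D ^ 4 = (D : ℝ) ^ 2 := by
    rw [show (4 : ℕ) = 2 * 2 from rfl, pow_mul, Real.sq_sqrt (by linarith)]
  have hKpow : 8 * K ^ 4 ≤ (Real.exp 1 + 2 * K) ^ 4 := by
    calc 8 * K ^ 4 ≤ (2 * K) ^ 4 := by rw [mul_pow]; nlinarith [pow_nonneg (zero_le_one.trans hK) 4]
      _ ≤ _ := by gcongr; linarith
  have hε4 : ε ^ 4 ≤ ε := pow_le_of_le_one hε.le hε1 (by norm_num)
  calc 8 * (D : ℝ) ^ 2 * K ^ 4 / ε ≤ 8 * (D : ℝ) ^ 2 * K ^ 4 / ε ^ 4 := by gcongr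
    _ = (8 * K ^ 4) * (D : ℝ) ^ 2 / ε ^ 4 := by ring
    _ ≤ (Real.exp 1 + 2 * K) ^ 4 * (D : ℝ) ^ 2 / ε ^ 4 := by gcongr
    _ = B ^ 4 := by rw [hB, div_pow, mul_pow, hD2]
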